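/- Let $\mathbb{K}$ be a field, $n$ a positive integer and $Q=(q_{ij})$ a multiplicatively antisymmetric $n\times n$ matrix over $\mathbb{K}$ (that is, $q_{ii}=1$, $q_{ij}\neq 0$ and $q_{ji}=q_{ij}^{-1}$ for all $i,j$). Let $\mathcal{A}=\mathcal{O}_Q(\mathbb{K}^n)$ be the quantum affine space, i.e. the $\mathbb{K}$-algebra generated by $x_1,\dots,x_n$ subject to $x_ix_j=q_{ij}x_jx_i$, and let $\mathcal{T}=\mathcal{O}_Q((\mathbb{K}^*)^n)$ be the quantum torus, i.e. the $\mathbb{K}$-algebra generated by $x_1^{\pm1},\dots,x_n^{\pm1}$ subject to the same relations and $x_ix_i^{-1}=1=x_i^{-1}x_i$. For a set $I$ of indices, the selectively localized quantum space $\mathcal{O}_Q(\mathbb{K}^n)_{\langle I\rangle}$ is the subalgebra of $\mathcal{T}$ generated by $x_1,\dots,x_n$ and the $x_i^{-1}$ with $i\in I$. Let $\Lambda=(\lambda_1,\dots,\lambda_n)\in(\mathbb{K}^*)^n$ and let $\sigma$ denote the toric automorphism $x_i\mapsto\lambda_ix_i$ of $\mathcal{T}$ and of $\mathcal{A}$.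 Suppose that $\sigma$ is outer on $\mathcal{T}$ (there is no unit $u$ of $\mathcal{T}$ with $\sigma(t)=u^{-1}tu$ for all $t\in\mathcal{T}$). Let $\delta$ be any $\sigma$-derivation of $\mathcal{A}$, i.e. a $\mathbb{K}$-linear map $\delta:\mathcal{A}\to\mathcal{A}$ with $\delta(rs)=\sigma(r)\delta(s)+\delta(r)s$ for all $r,s\in\mathcal{A}$, and let $S=\mathcal{A}[z;\sigma,\delta]$ be an Ore extension: a $\mathbb{K}$-algebra extension of $\mathcal{A}$ that is a free left $\mathcal{A}$-module with basis $1,z,z^2,\dots$ and in which $zr=\sigma(r)z+\delta(r)$ for all $r\in\mathcal{A}$. Then there exist an element $w\in S$ that is normal in $S$ (i.e. $Sw=wS$) and a subset $J=\{j_1<\dots<j_m\}\subseteq\{1,\dots,n\}$ such that, with $x=x_{j_1}x_{j_2}\cdots x_{j_m}$, the following hold. The set $\{x^i:i\ge 0\}$ is a right and left Ore set in $S$, and the localization $S_x$ of $S$ at this set is the selectively localized quantum space $\mathcal{O}_{Q'}(\mathbb{K}^{n+1})_{\langle J\rangle}$ with canonical generators $x_1,\dots,x_n,x_{n+1}=w$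 and $x_j^{-1}$ $(j\in J)$; that is, there is a $\mathbb{K}$-algebra isomorphism from $S_x$ onto $\mathcal{O}_{Q'}(\mathbb{K}^{n+1})_{\langle J\rangle}$ that sends the image of $x_i$ to $x_i$ for $1\le i\le n$ and the image of $w$ to $x_{n+1}$. Here $Q'$ is the multiplicatively antisymmetric $(n+1)\times(n+1)$ matrix obtained from $Q$ by appending the final row with entries $q'_{(n+1)i}=\lambda_i\prod_{j\in J}q_{ji}$ for $1\le i\le n$. Moreover, for every $i\in\{1,\dots,n\}\setminus J$, the element $x_i$ is normal in $S$. -/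

import Mathlib

noncomputable section

/-- `Q` is multiplicatively antisymmetric. -/
def IsMulAntisymm {K : Type*} [Field K] {m : ℕ} (Q : Matrix (Fin m) (Fin m) K) : Prop :=
  (∀ i, Q i i = 1) ∧ ∀ i j, Q i j ≠ 0 ∧ Q j i = (Q i j)⁻¹

namespace QuantumSpace

variable {K : Type*} [Field K] {m : ℕ}

/-- The defining relations `x_i x_j = q_{ij} x_j x_i` of quantum affine space. -/
inductive Rel (Q : Matrix (Fin m) (Fin m) K) :
    FreeAlgebra K (Fin m) → FreeAlgebra K (Fin m) → Prop
  | comm (i j : Fin m) : Rel Q (FreeAlgebra.ι K i * FreeAlgebra.ι K j)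
      (Q i j • (FreeAlgebra.ι K j * FreeAlgebra.ι K i))

end QuantumSpace

/-- Quantum affine space `O_Q(K^m)`: the `K`-algebra generated by `x_1, …, x_m` subject to
`x_i x_j = q_{ij} x_j x_i`. -/
abbrev QuantumSpace {K : Type*} [Field K] {m : ℕ} (Q : Matrix (Fin m) (Fin m) K) : Type _ :=
  RingQuot (QuantumSpace.Rel Q)

namespace QuantumSpace

variable {K : Type*} [Field K] {m : ℕ}

/-- The canonical generator `x_i` of quantum affine space. -/
def x (Q : Matrix (Fin m) (Fin m) K) (i : Fin m) : QuantumSpace Q :=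
  RingQuot.mkAlgHom K (Rel Q) (FreeAlgebra.ι K i)

theorem x_mul_x (Q : Matrix (Fin m) (Fin m) K) (i j : Fin m) :
    x Q i * x Q j = Q i j • (x Q j * x Q i) := by
  simpa [x] using RingQuot.mkAlgHom_rel K (Rel.comm (Q := Q) i j)

theorem hom_ext {Q : Matrix (Fin m) (Fin m) K} {B : Type*} [Semiring B] [Algebra K B]
    {f g : QuantumSpace Q →ₐ[K] B} (h : ∀ i, f (x Q i) = g (x Q i)) : f = g := by
  apply RingQuot.ringQuot_ext'
  ext i
  exact h i

/-- The algebra endomorphism `x_i ↦ λ_i x_i`. -/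
def toricHom (Q : Matrix (Fin m) (Fin m) K) (Λ : Fin m → Kˣ) :
    QuantumSpace Q →ₐ[K] QuantumSpace Q :=
  RingQuot.liftAlgHom K ⟨FreeAlgebra.lift K fun i => (Λ i : K) • x Q i, by
    rintro _ _ ⟨i, j⟩
    simp only [map_mul, map_smul, FreeAlgebra.lift_ι_apply, smul_mul_smul_comm, x_mul_x Q i j,
      smul_smul]
    congr 1
    ring⟩

@[simp] theorem toricHom_x (Q : Matrix (Fin m) (Fin m) K) (Λ : Fin m → Kˣ) (i : Fin m) :
    toricHom Q Λ (x Q i) = (Λ i : K) • x Q i := by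
  simp [toricHom, x]

/-- The toric automorphism `σ_Λ` of quantum affine space, with `σ_Λ(x_i) = λ_i x_i`. -/
def toric (Q : Matrix (Fin m) (Fin m) K) (Λ : Fin m → Kˣ) :
    QuantumSpace Q ≃ₐ[K] QuantumSpace Q :=
  AlgEquiv.ofAlgHom (toricHom Q Λ) (toricHom Q Λ⁻¹)
    (hom_ext fun i => by simp [smul_smul]) (hom_ext fun i => by simp [smul_smul])

end QuantumSpace

namespace QuantumTorus

variable {K : Type*} [Field K] {m : ℕ}

/-- The defining relations of the quantum torus; the generator `Sum.inl i` is `x_i` and the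
generator `Sum.inr i` is `x_i⁻¹`. -/
inductive Rel (Q : Matrix (Fin m) (Fin m) K) :
    FreeAlgebra K (Fin m ⊕ Fin m) → FreeAlgebra K (Fin m ⊕ Fin m) → Prop
  | comm (i j : Fin m) :
      Rel Q (FreeAlgebra.ι K (Sum.inl i) * FreeAlgebra.ι K (Sum.inl j))
        (Q i j • (FreeAlgebra.ι K (Sum.inl j) * FreeAlgebra.ι K (Sum.inl i)))
  | mul_inv (i : Fin m) :
      Rel Q (FreeAlgebra.ι K (Sum.inl i) * FreeAlgebra.ι K (Sum.inr i)) 1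
  | inv_mul (i : Fin m) :
      Rel Q (FreeAlgebra.ι K (Sum.inr i) * FreeAlgebra.ι K (Sum.inl i)) 1

end QuantumTorus

/-- The quantum torus `O_Q((K^*)^m)`: the `K`-algebra generated by `x_1^{±1}, …, x_m^{±1}` subject
to `x_i x_j = q_{ij} x_j x_i` and `x_i x_i⁻¹ = 1 = x_i⁻¹ x_i`. -/
abbrev QuantumTorus {K : Type*} [Field K] {m : ℕ} (Q : Matrix (Fin m) (Fin m) K) : Type _ :=
  RingQuot (QuantumTorus.Rel Q)

namespace QuantumTorus

variable {K : Type*} [Field K] {m : ℕ}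

/-- The canonical generator `x_i` of the quantum torus. -/
def x (Q : Matrix (Fin m) (Fin m) K) (i : Fin m) : QuantumTorus Q :=
  RingQuot.mkAlgHom K (Rel Q) (FreeAlgebra.ι K (Sum.inl i))

/-- The canonical generator `x_i⁻¹` of the quantum torus. -/
def xInv (Q : Matrix (Fin m) (Fin m) K) (i : Fin m) : QuantumTorus Q :=
  RingQuot.mkAlgHom K (Rel Q) (FreeAlgebra.ι K (Sum.inr i))

theorem x_mul_x (Q : Matrix (Fin m) (Fin m) K) (i j : Fin m) :
    x Q i * x Q j = Q i j • (x Q j * x Q i) := by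
  simpa [x] using RingQuot.mkAlgHom_rel K (Rel.comm (Q := Q) i j)

@[simp] theorem x_mul_xInv (Q : Matrix (Fin m) (Fin m) K) (i : Fin m) :
    x Q i * xInv Q i = 1 := by
  simpa [x, xInv] using RingQuot.mkAlgHom_rel K (Rel.mul_inv (Q := Q) i)

@[simp] theorem xInv_mul_x (Q : Matrix (Fin m) (Fin m) K) (i : Fin m) :
    xInv Q i * x Q i = 1 := by
  simpa [x, xInv] using RingQuot.mkAlgHom_rel K (Rel.inv_mul (Q := Q) i)

theorem hom_ext {Q : Matrix (Fin m) (Fin m) K} {B : Type*} [Semiring B] [Algebra K B]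
    {f g : QuantumTorus Q →ₐ[K] B} (h : ∀ i, f (x Q i) = g (x Q i))
    (h' : ∀ i, f (xInv Q i) = g (xInv Q i)) : f = g := by
  apply RingQuot.ringQuot_ext'
  ext (i | i)
  · exact h i
  · exact h' i

/-- The algebra endomorphism `x_i ↦ λ_i x_i`, `x_i⁻¹ ↦ λ_i⁻¹ x_i⁻¹`. -/
def toricHom (Q : Matrix (Fin m) (Fin m) K) (Λ : Fin m → Kˣ) :
    QuantumTorus Q →ₐ[K] QuantumTorus Q :=
  RingQuot.liftAlgHom K ⟨FreeAlgebra.lift K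
      (Sum.elim (fun i => (Λ i : K) • x Q i) fun i => ((Λ i)⁻¹ : K) • xInv Q i), by
    rintro _ _ (⟨i, j⟩ | i | i)
    · simp only [map_mul, map_smul, FreeAlgebra.lift_ι_apply, Sum.elim_inl, smul_mul_smul_comm,
        x_mul_x Q i j, smul_smul]
      congr 1
      ring
    · simp
    · simp⟩

@[simp] theorem toricHom_x (Q : Matrix (Fin m) (Fin m) K) (Λ : Fin m → Kˣ) (i : Fin m) :
    toricHom Q Λ (x Q i) = (Λ i : K) • x Q i := by
  simp [toricHom, x]

@[simp] theorem toricHom_xInv (Q : Matrix (Fin m) (Fin m) K) (Λ : Fin m → Kˣ) (i : Fin m) :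
    toricHom Q Λ (xInv Q i) = ((Λ i)⁻¹ : K) • xInv Q i := by
  simp [toricHom, xInv]

/-- The toric automorphism `σ_Λ` of the quantum torus, with `σ_Λ(x_i) = λ_i x_i`. -/
def toric (Q : Matrix (Fin m) (Fin m) K) (Λ : Fin m → Kˣ) :
    QuantumTorus Q ≃ₐ[K] QuantumTorus Q :=
  AlgEquiv.ofAlgHom (toricHom Q Λ) (toricHom Q Λ⁻¹)
    (hom_ext (fun i => by simp [smul_smul]) fun i => by simp [smul_smul])
    (hom_ext (fun i => by simp [smul_smul]) fun i => by simp [smul_smul])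

end QuantumTorus

/-- The selectively localized quantum space `O_Q(K^m)_{⟨I⟩}`: the subalgebra of the quantum torus
generated by all `x_i` and by the `x_i⁻¹` with `i ∈ I`. -/
def selectivelyLocalizedQuantumSpace {K : Type*} [Field K] {m : ℕ}
    (Q : Matrix (Fin m) (Fin m) K) (I : Finset (Fin m)) : Subalgebra K (QuantumTorus Q) :=
  Algebra.adjoin K (Set.range (QuantumTorus.x Q) ∪ QuantumTorus.xInv Q '' (I : Set (Fin m)))

section SkewDerivations

variable {K R S : Type*} [Field K] [Ring R] [Algebra K R] [Ring S] [Algebra K S]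

/-- `σ` is an inner automorphism: `σ(r) = u⁻¹ r u` for some unit `u`. -/
def IsInnerAut (σ : R ≃ₐ[K] R) : Prop :=
  ∃ u : Rˣ, ∀ r, σ r = (↑u⁻¹ : R) * r * (u : R)

/-- `δ` is a (left) `σ`-derivation. -/
def IsSkewDerivation (σ : R ≃ₐ[K] R) (δ : R →ₗ[K] R) : Prop :=
  ∀ r s, δ (r * s) = σ r * δ s + δ r * s

/-- `S`, with structure map `f : R → S` and indeterminate `z`, is an Ore extension `R[z; σ, δ]`:
`S` is a free left `R`-module with basis `1, z, z², …`, and `z r = σ(r) z + δ(r)` for `r ∈ R`. -/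
structure IsOreExtension (σ : R ≃ₐ[K] R) (δ : R →ₗ[K] R) (f : R →ₐ[K] S) (z : S) : Prop where
  basis : Function.Bijective fun p : ℕ →₀ R => p.sum fun k r => f r * z ^ k
  comm : ∀ r, z * f r = f (σ r) * z + f (δ r)

/-- `w` is a normal element of `S`: `S w = w S`. -/
def IsNormalElement {S : Type*} [Ring S] (w : S) : Prop :=
  (Set.range fun s => s * w) = Set.range fun s => w * s

end SkewDerivations

/-- The product `x_{j_1} ⋯ x_{j_k}` in quantum affine space, where `J = {j_1 < ⋯ < j_k}`. -/
def QuantumSpace.xProd {K : Type*} [Field K] {m : ℕ} (Q : Matrix (Fin m) (Fin m) K)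
    (J : Finset (Fin m)) : QuantumSpace Q :=
  ((J.sort (· ≤ ·)).map (QuantumSpace.x Q)).prod

end

/-! The quantum torus is graded by exponent vectors, and conjugation by x^α multiplies x_i by a
scalar `mu hQ α i`. As σ is outer, no α has `mu hQ α = Λ`. Comparing coefficients in δ(x_i x_j) =
q_ij δ(x_j x_i) therefore yields d in the torus with δ(r) = d r - σ(r) d (`exists_inner`). Formally
θ = z - d satisfies θ r = σ(r) θ.

That δ preserves quantum affine space restricts d: the coefficient of x^α in x_i⁻¹ δ(x_i) is (mu_i -
λ_i) d_α, so d_α ≠ 0 and mu_i ≠ λ_i force α + e_i ≥ 0. Hence an exponent of d has at most one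
negative entry α_i, which equals -1, and then mu_j = λ_j for all j ≠ i (`IsAdmissible.mu_eq`,
`IsAdmissible.eq_neg_one`). Let J collect these positions i and put x = x_J. Then x d has no
negative exponents, so w = x θ = x z - x d lies in S. Conjugation by w is a toric automorphism τ on
the x_i, and w z = (P⁻¹ z + b) w with P = ∏_{j ∈ J} λ_j and b = τ(d) - P⁻¹ d. The element b lies in
quantum affine space because its coefficients vanish at the negative exponents of d
(`IsAdmissible.weight_eq`). So w is normal. For i ∉ J the negative exponents of d do not contribute
to δ(x_i), which is then a left and a right multiple of x_i; this makes x_i normal.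

For the localization, S embeds into the torus of Q' by z ↦ x_J⁻¹ x_{n+1} + d; injectivity follows
from the degree in x_{n+1} (`sum_extend_ne_zero`). The image lies in the selectively localized
space, contains x_1, …, x_{n+1}, and receives every element of that space after multiplication by a
power of x_J on either side. By `exists_oreLocalization_algEquiv` this identifies the localization.
-/

noncomputable section

/-! ### Generators and universal property of quantum affine space. -/

namespace QuantumSpace

variable {K : Type*} [Field K] {m : ℕ}

/-- The universal property of quantum affine space. -/
def lift {Q : Matrix (Fin m) (Fin m) K} {B : Type*} [Ring B] [Algebra K B] (y : Fin m → B)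
    (hy : ∀ i j, y i * y j = Q i j • (y j * y i)) : QuantumSpace Q →ₐ[K] B :=
  RingQuot.liftAlgHom K ⟨FreeAlgebra.lift K y, by
    rintro _ _ ⟨i, j⟩
    simp [hy i j]⟩

@[simp] theorem lift_x {Q : Matrix (Fin m) (Fin m) K} {B : Type*} [Ring B] [Algebra K B]
    (y : Fin m → B) (hy : ∀ i j, y i * y j = Q i j • (y j * y i)) (i : Fin m) :
    lift y hy (x Q i) = y i := by
  simp [lift, x]

theorem adjoin_range_x (Q : Matrix (Fin m) (Fin m) K) :
    Algebra.adjoin K (Set.range (x Q)) = ⊤ := by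
  refine top_unique fun a _ => ?_
  obtain ⟨a, rfl⟩ := RingQuot.mkAlgHom_surjective K (Rel Q) a
  induction a using FreeAlgebra.induction with
  | grade0 r => rw [AlgHom.commutes]; exact Subalgebra.algebraMap_mem _ _
  | grade1 i => exact Algebra.subset_adjoin ⟨i, rfl⟩
  | mul a b ha hb => rw [map_mul]; exact mul_mem (ha trivial) (hb trivial)
  | add a b ha hb => rw [map_add]; exact add_mem (ha trivial) (hb trivial)

end QuantumSpace

/-! ### Laurent monomials as units of the quantum torus. -/

namespace QuantumTorus

variable {K : Type*} [Field K] {m : ℕ}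

theorem adjoin_range (Q : Matrix (Fin m) (Fin m) K) :
    Algebra.adjoin K (Set.range (x Q) ∪ Set.range (xInv Q)) = ⊤ := by
  refine top_unique fun a _ => ?_
  obtain ⟨a, rfl⟩ := RingQuot.mkAlgHom_surjective K (Rel Q) a
  induction a using FreeAlgebra.induction with
  | grade0 r => rw [AlgHom.commutes]; exact Subalgebra.algebraMap_mem _ _
  | grade1 i =>
    rcases i with i | i
    · exact Algebra.subset_adjoin (Or.inl ⟨i, rfl⟩)
    · exact Algebra.subset_adjoin (Or.inr ⟨i, rfl⟩)
  | mul a b ha hb => rw [map_mul]; exact mul_mem (ha trivial) (hb trivial)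
  | add a b ha hb => rw [map_add]; exact add_mem (ha trivial) (hb trivial)

/-- The generator `x_i` as a unit of the quantum torus. -/
def xUnit (Q : Matrix (Fin m) (Fin m) K) (i : Fin m) : (QuantumTorus Q)ˣ :=
  ⟨x Q i, xInv Q i, x_mul_xInv Q i, xInv_mul_x Q i⟩

@[simp] theorem val_xUnit (Q : Matrix (Fin m) (Fin m) K) (i : Fin m) :
    (xUnit Q i : QuantumTorus Q) = x Q i := rfl

@[simp] theorem val_inv_xUnit (Q : Matrix (Fin m) (Fin m) K) (i : Fin m) :
    (↑(xUnit Q i)⁻¹ : QuantumTorus Q) = xInv Q i := rfl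

/-- The universal property of the quantum torus. -/
def lift {Q : Matrix (Fin m) (Fin m) K} {B : Type*} [Ring B] [Algebra K B] (y : Fin m → Bˣ)
    (hy : ∀ i j, (y i * y j : B) = Q i j • (y j * y i : B)) : QuantumTorus Q →ₐ[K] B :=
  RingQuot.liftAlgHom K ⟨FreeAlgebra.lift K
      (Sum.elim (fun i => (y i : B)) fun i => (↑(y i)⁻¹ : B)), by
    rintro _ _ (⟨i, j⟩ | i | i)
    · simp [hy i j]
    · simp
    · simp⟩

@[simp] theorem lift_x {Q : Matrix (Fin m) (Fin m) K} {B : Type*} [Ring B] [Algebra K B]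
    (y : Fin m → Bˣ) (hy : ∀ i j, (y i * y j : B) = Q i j • (y j * y i : B)) (i : Fin m) :
    lift y hy (x Q i) = y i := by
  simp [lift, x]

/-- Scalars as units of the quantum torus. -/
def scalar (Q : Matrix (Fin m) (Fin m) K) : Kˣ →* (QuantumTorus Q)ˣ :=
  Units.map (algebraMap K (QuantumTorus Q) : K →* QuantumTorus Q)

theorem val_scalar (Q : Matrix (Fin m) (Fin m) K) (c : Kˣ) :
    (scalar Q c : QuantumTorus Q) = algebraMap K _ (c : K) := rfl

theorem scalar_comm (Q : Matrix (Fin m) (Fin m) K) (c : Kˣ) (u : (QuantumTorus Q)ˣ) :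
    scalar Q c * u = u * scalar Q c :=
  Units.ext (Algebra.commutes _ _)

/-- `HasDegree β u` says that the unit `u` is a scalar multiple of a Laurent monomial with
exponent vector `β`. -/
inductive HasDegree (Q : Matrix (Fin m) (Fin m) K) : (Fin m → ℤ) → (QuantumTorus Q)ˣ → Prop
  | x (i : Fin m) : HasDegree Q (Pi.single i 1) (xUnit Q i)
  | scalar (c : Kˣ) : HasDegree Q 0 (scalar Q c)
  | mul {β γ : Fin m → ℤ} {u v : (QuantumTorus Q)ˣ} :
      HasDegree Q β u → HasDegree Q γ v → HasDegree Q (β + γ) (u * v)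
  | inv {β : Fin m → ℤ} {u : (QuantumTorus Q)ˣ} : HasDegree Q β u → HasDegree Q (-β) u⁻¹

variable {Q : Matrix (Fin m) (Fin m) K}

namespace HasDegree

theorem one : HasDegree Q 0 1 := by
  simpa using HasDegree.scalar (Q := Q) 1

theorem list_prod {ι : Type*} {β : ι → Fin m → ℤ} {u : ι → (QuantumTorus Q)ˣ}
    (h : ∀ i, HasDegree Q (β i) (u i)) (l : List ι) :
    HasDegree Q (l.map β).sum (l.map u).prod := by
  induction l with
  | nil => exact one
  | cons i l ih => simpa using (h i).mul ih

theorem pow {β : Fin m → ℤ} {u : (QuantumTorus Q)ˣ} (h : HasDegree Q β u) (k : ℕ) :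
    HasDegree Q (k • β) (u ^ k) := by
  simpa using list_prod (fun _ : Unit => h) (List.replicate k ())

theorem zpow {β : Fin m → ℤ} {u : (QuantumTorus Q)ˣ} (h : HasDegree Q β u) (k : ℤ) :
    HasDegree Q (k • β) (u ^ k) := by
  obtain ⟨k, rfl | rfl⟩ := k.eq_nat_or_neg
  · simpa using h.pow k
  · simpa using (h.pow k).inv

end HasDegree

theorem exists_hasDegree (Q : Matrix (Fin m) (Fin m) K) (β : Fin m → ℤ) :
    ∃ u, HasDegree Q β u := by
  refine ⟨((List.finRange m).map fun i => xUnit Q i ^ β i).prod, ?_⟩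
  have := HasDegree.list_prod (fun i => (HasDegree.x (Q := Q) i).zpow (β i)) (List.finRange m)
  convert this using 1
  rw [← List.ofFn_eq_map, List.sum_ofFn]
  ext j
  simp [Finset.sum_apply, Pi.single_apply]

/-- Modulo the central scalars the generators commute, so the class of a monomial is the image of
its exponent vector under a homomorphism from ℤ^m. -/
theorem HasDegree.exists_scalar (hQ : IsMulAntisymm Q) {β : Fin m → ℤ} {u v : (QuantumTorus Q)ˣ}
    (hu : HasDegree Q β u) (hv : HasDegree Q β v) :
    ∃ c : Kˣ, v = QuantumTorus.scalar Q c * u := by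
  let N : Subgroup (QuantumTorus Q)ˣ := (QuantumTorus.scalar Q).range
  have hN : N.Normal := ⟨by
    rintro _ ⟨c, rfl⟩ g
    exact ⟨c, by rw [← scalar_comm, mul_inv_cancel_right]⟩⟩
  have hcomm : ∀ i j, Commute (xUnit Q i : (QuantumTorus Q)ˣ ⧸ N) (xUnit Q j) := by
    intro i j
    change ((xUnit Q i * xUnit Q j : (QuantumTorus Q)ˣ) : _ ⧸ N) = (xUnit Q j * xUnit Q i :)
    have : xUnit Q i * xUnit Q j =
        QuantumTorus.scalar Q (Units.mk0 _ (hQ.2 i j).1) * (xUnit Q j * xUnit Q i) := by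
      ext
      simp [val_scalar, x_mul_x Q i j, Algebra.smul_def]
    rw [this, scalar_comm]
    exact QuotientGroup.mk_mul_of_mem _ ⟨_, rfl⟩
  let M : (Fin m → Multiplicative ℤ) →* (QuantumTorus Q)ˣ ⧸ N :=
    MonoidHom.noncommPiCoprod (fun i => zpowersHom _ (xUnit Q i : (QuantumTorus Q)ˣ ⧸ N))
      fun i j _ a b => (hcomm i j).zpow_zpow _ _
  have key : ∀ {β u}, HasDegree Q β u →
      (u : (QuantumTorus Q)ˣ ⧸ N) = M fun i => Multiplicative.ofAdd (β i) := by
    intro β u h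
    induction h with
    | x i =>
      have : (fun j => Multiplicative.ofAdd ((Pi.single i 1 : Fin m → ℤ) j)) =
          Pi.mulSingle i (Multiplicative.ofAdd 1) := by
        ext j
        by_cases h : j = i
        · subst h; simp
        · simp [h]
      rw [this]
      exact Eq.symm ((MonoidHom.noncommPiCoprod_mulSingle _ i _).trans (by simp))
    | scalar c =>
      have : (fun i => Multiplicative.ofAdd ((0 : Fin m → ℤ) i)) = 1 := rfl
      rw [this, map_one, QuotientGroup.eq_one_iff]
      exact ⟨c, rfl⟩
    | mul _ _ h₁ h₂ =>
      rw [QuotientGroup.mk_mul, h₁, h₂, ← map_mul]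
      rfl
    | inv _ h =>
      rw [QuotientGroup.mk_inv, h, ← map_inv]
      rfl
  obtain ⟨c, hc⟩ := QuotientGroup.eq.1 ((key hu).trans (key hv).symm)
  exact ⟨c, by rw [scalar_comm, hc, mul_inv_cancel_left]⟩

/-- If `v` intertwines two homomorphisms on the generators then it does so everywhere. -/
theorem intertwine {B : Type*} [Ring B] [Algebra K B] {g h : QuantumTorus Q →ₐ[K] B} {v : B}
    (H : ∀ i, v * g (x Q i) = h (x Q i) * v) (t : QuantumTorus Q) : v * g t = h t * v := by
  have ht : t ∈ Algebra.adjoin K (Set.range (x Q) ∪ Set.range (xInv Q)) := by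
    rw [adjoin_range]; trivial
  induction ht using Algebra.adjoin_induction with
  | mem t ht =>
    rcases ht with ⟨i, rfl⟩ | ⟨i, rfl⟩
    · exact H i
    · calc v * g (xInv Q i) = h (xInv Q i * x Q i) * v * g (xInv Q i) := by simp
        _ = h (xInv Q i) * (v * g (x Q i)) * g (xInv Q i) := by rw [H, map_mul]; noncomm_ring
        _ = h (xInv Q i) * v * g (x Q i * xInv Q i) := by rw [map_mul]; noncomm_ring
        _ = _ := by simp
  | algebraMap r => simp [Algebra.commutes]
  | add a b _ _ ha hb => simp [mul_add, add_mul, ha, hb]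
  | mul a b _ _ ha hb => rw [map_mul, map_mul, ← mul_assoc, ha, mul_assoc, hb, mul_assoc]

theorem HasDegree.toric {β : Fin m → ℤ} {u : (QuantumTorus Q)ˣ} (hu : HasDegree Q β u)
    (Λ : Fin m → Kˣ) :
    toricHom Q Λ u = ((∏ i, Λ i ^ β i : Kˣ) : K) • (u : QuantumTorus Q) := by
  induction hu with
  | x i =>
    simp only [val_xUnit, toricHom_x]
    congr 2
    rw [Finset.prod_eq_single i] <;> simp +contextual
  | scalar c => simp [val_scalar]
  | mul _ _ h₁ h₂ =>
    simp [h₁, h₂, zpow_add, Finset.prod_mul_distrib, smul_smul, mul_comm]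
  | @inv β u _ h =>
    have : toricHom Q Λ ↑u⁻¹ * toricHom Q Λ u = 1 := by rw [← map_mul]; simp
    rw [h] at this
    rw [← Units.mul_left_inj u]
    simp only [Pi.neg_apply, zpow_neg, smul_mul_assoc, Units.inv_mul]
    rw [mul_smul_comm] at this
    rw [← this, smul_smul, ← Units.val_mul, ← Finset.prod_mul_distrib]
    simp

end QuantumTorus

/-! ### Commutation scalars, the regular representation and the monomial basis. -/

namespace QuantumTorus

variable {K : Type*} [Field K] {m : ℕ} {Q : Matrix (Fin m) (Fin m) K}

/-- The unit `q_{ij}`. -/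
def _root_.IsMulAntisymm.unit (hQ : IsMulAntisymm Q) (i j : Fin m) : Kˣ :=
  Units.mk0 (Q i j) (hQ.2 i j).1

theorem _root_.IsMulAntisymm.val_unit (hQ : IsMulAntisymm Q) (i j : Fin m) :
    (hQ.unit i j : K) = Q i j := rfl

theorem _root_.IsMulAntisymm.unit_self (hQ : IsMulAntisymm Q) (i : Fin m) :
    hQ.unit i i = 1 := Units.ext (hQ.1 i)

theorem _root_.IsMulAntisymm.unit_inv (hQ : IsMulAntisymm Q) (i j : Fin m) :
    (hQ.unit i j)⁻¹ = hQ.unit j i := Units.ext (by simp [hQ.val_unit, (hQ.2 i j).2])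

/-- The scalar `μ` with `x^α x_i = μ x_i x^α`. -/
def mu (hQ : IsMulAntisymm Q) (α : Fin m → ℤ) (i : Fin m) : Kˣ := ∏ k, hQ.unit k i ^ α k

theorem x_mul (hQ : IsMulAntisymm Q) (i : Fin m) (t : QuantumTorus Q) :
    x Q i * t = toricHom Q (hQ.unit i) t * x Q i :=
  intertwine (g := AlgHom.id K _) (fun j => by simp [x_mul_x Q i j, hQ.val_unit]) t

theorem HasDegree.mul_x (hQ : IsMulAntisymm Q) {α : Fin m → ℤ} {u : (QuantumTorus Q)ˣ}
    (hu : HasDegree Q α u) (i : Fin m) :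
    (u * QuantumTorus.x Q i : QuantumTorus Q) = (mu hQ α i : K) • (QuantumTorus.x Q i * u) := by
  rw [x_mul hQ, hu.toric, smul_mul_assoc, smul_smul, ← Units.val_mul, mu,
    ← Finset.prod_mul_distrib]
  simp [← hQ.unit_inv i]

theorem HasDegree.mul_eq (hQ : IsMulAntisymm Q) {α : Fin m → ℤ} {u : (QuantumTorus Q)ˣ}
    (hu : HasDegree Q α u) (t : QuantumTorus Q) :
    u * t = toricHom Q (mu hQ α) t * u :=
  intertwine (g := AlgHom.id K _)
    (fun j => by simpa using hu.mul_x hQ j) t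

/-- A monomial x^α commutes with itself, so the scalar it produces on itself is 1. -/
theorem prod_mu_zpow [Nontrivial (QuantumTorus Q)] (hQ : IsMulAntisymm Q) (α : Fin m → ℤ) :
    ∏ i, mu hQ α i ^ α i = 1 := by
  obtain ⟨u, hu⟩ := exists_hasDegree Q α
  have h := hu.mul_eq hQ u
  rw [hu.toric, Units.mul_left_inj] at h
  have : algebraMap K (QuantumTorus Q) (∏ i, mu hQ α i ^ α i : Kˣ) = algebraMap K _ 1 := by
    rw [← Units.mul_left_inj u, ← Algebra.smul_def, ← h]
    simp
  exact Units.ext ((algebraMap K (QuantumTorus Q)).injective this)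

/-- The scalar by which `x_i` acts on `x^β` in the regular representation. -/
def repCoeff (hQ : IsMulAntisymm Q) (i : Fin m) (β : Fin m → ℤ) : Kˣ :=
  -- Left multiplication by x_i on ordered monomials moves x_i past the x_k with k < i only.
  ∏ k, (if k < i then hQ.unit i k else 1) ^ β k

theorem repCoeff_sub (hQ : IsMulAntisymm Q) (i : Fin m) (β γ : Fin m → ℤ) :
    repCoeff hQ i (β - γ) = repCoeff hQ i β * (repCoeff hQ i γ)⁻¹ := by
  simp only [repCoeff, Pi.sub_apply, zpow_sub, Finset.prod_mul_distrib, Finset.prod_inv_distrib]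

theorem repCoeff_single (hQ : IsMulAntisymm Q) (i j : Fin m) :
    repCoeff hQ i (Pi.single j 1) = if j < i then hQ.unit i j else 1 := by
  rw [repCoeff, Finset.prod_eq_single j] <;> simp +contextual

/-- The action of `x_i` on functions on the exponent lattice. -/
def repUnit (hQ : IsMulAntisymm Q) (i : Fin m) : (Module.End K ((Fin m → ℤ) → K))ˣ where
  val :=
    { toFun := fun F β => (repCoeff hQ i β : K) * F (β - Pi.single i 1)
      map_add' := fun F G => by ext; simp [mul_add]
      map_smul' := fun c F => by ext; simp; ring }
  inv :=
    { toFun := fun F β => (↑(repCoeff hQ i (β + Pi.single i 1))⁻¹ : K) * F (β + Pi.single i 1)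
      map_add' := fun F G => by ext; simp [mul_add]
      map_smul' := fun c F => by ext; simp; ring }
  val_inv := by ext; simp
  inv_val := by ext; simp

theorem repUnit_apply (hQ : IsMulAntisymm Q) (i : Fin m) (F : (Fin m → ℤ) → K) (β : Fin m → ℤ) :
    (repUnit hQ i : Module.End K ((Fin m → ℤ) → K)) F β =
      (repCoeff hQ i β : K) * F (β - Pi.single i 1) := rfl

/-- The regular representation of the quantum torus. -/
def rep (hQ : IsMulAntisymm Q) : QuantumTorus Q →ₐ[K] Module.End K ((Fin m → ℤ) → K) :=
  lift (repUnit hQ) fun i j => by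
    refine LinearMap.ext fun F => funext fun β => ?_
    have h : (repCoeff hQ j (Pi.single i 1))⁻¹ =
        hQ.unit i j * (repCoeff hQ i (Pi.single j 1))⁻¹ := by
      rw [repCoeff_single, repCoeff_single]
      rcases lt_trichotomy i j with h | rfl | h
      · simp [h, h.not_gt, hQ.unit_inv]
      · simp [hQ.unit_self]
      · simp [h, h.not_gt]
    have h' : (repCoeff hQ i β : K) * (repCoeff hQ j (β - Pi.single i 1) : Kˣ) =
        Q i j * ((repCoeff hQ j β : K) * (repCoeff hQ i (β - Pi.single j 1) : Kˣ)) := by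
      rw [← hQ.val_unit, ← Units.val_mul, ← Units.val_mul, ← Units.val_mul, repCoeff_sub,
        repCoeff_sub, h]
      congr 1
      ac_rfl
    simp only [Module.End.mul_apply, LinearMap.smul_apply, Pi.smul_apply, repUnit_apply,
      smul_eq_mul]
    rw [← mul_assoc, h', sub_right_comm]
    ring

theorem HasDegree.exists_rep (hQ : IsMulAntisymm Q) {β : Fin m → ℤ} {u : (QuantumTorus Q)ˣ}
    (hu : HasDegree Q β u) (γ : Fin m → ℤ) :
    ∃ c : Kˣ, rep hQ u (Pi.single γ 1) = c • Pi.single (γ + β) 1 := by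
  induction hu generalizing γ with
  | x i =>
    refine ⟨repCoeff hQ i (γ + Pi.single i 1), funext fun β => ?_⟩
    by_cases h : β = γ + Pi.single i 1
    · subst h
      simp [rep, repUnit_apply, Units.smul_def]
    · have h' : β - Pi.single i 1 ≠ γ := fun h' => h (by rw [← h', sub_add_cancel])
      simp [rep, repUnit_apply, h, h']
  | scalar c => exact ⟨c, by simp [val_scalar, Units.smul_def, Module.algebraMap_end_apply]⟩
  | @mul β δ u v _ _ h₁ h₂ =>
    obtain ⟨c, hc⟩ := h₂ γ
    obtain ⟨d, hd⟩ := h₁ (γ + δ)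
    refine ⟨c * d, ?_⟩
    simp only [Units.val_mul, map_mul, Module.End.mul_apply, hc]
    rw [Units.smul_def, map_smul, hd, ← Units.smul_def, smul_smul, add_right_comm, add_assoc]
  | @inv β u _ h =>
    obtain ⟨c, hc⟩ := h (γ - β)
    refine ⟨c⁻¹, ?_⟩
    rw [sub_add_cancel] at hc
    have := congrArg (rep hQ ↑u⁻¹) hc
    rw [← Module.End.mul_apply, ← map_mul, Units.inv_mul, map_one, Module.End.one_apply,
      Units.smul_def, map_smul, ← Units.smul_def] at this
    rw [← sub_eq_add_neg, this, inv_smul_smul]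

/-- In the regular representation, monomials send the delta function at 0 to nonzero multiples of
distinct delta functions. -/
theorem linearIndependent_of_hasDegree (hQ : IsMulAntisymm Q) {ι : Type*} {β : ι → Fin m → ℤ}
    (hβ : Function.Injective β) {u : ι → (QuantumTorus Q)ˣ} (hu : ∀ i, HasDegree Q (β i) (u i)) :
    LinearIndependent K fun i => (u i : QuantumTorus Q) := by
  choose c hc using fun i => (hu i).exists_rep hQ 0
  refine LinearIndependent.of_comp
    ((LinearMap.applyₗ (Pi.single (0 : Fin m → ℤ) (1 : K))).comp (rep hQ).toLinearMap) ?_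
  have h₁ : LinearIndependent K fun i => (Pi.single (β i) 1 : (Fin m → ℤ) → K) :=
    (Pi.linearIndependent_single_one (Fin m → ℤ) K).comp β hβ
  convert h₁.units_smul c using 1
  ext1 i
  simpa using hc i

theorem nontrivial (hQ : IsMulAntisymm Q) : Nontrivial (QuantumTorus Q) :=
  ⟨_, _, (linearIndependent_of_hasDegree hQ (β := fun _ : Unit => 0)
    (Function.injective_of_subsingleton _) fun _ => HasDegree.one).ne_zero ()⟩

/-- The span of the Laurent monomials with exponent vectors in `s`. -/
def homog (Q : Matrix (Fin m) (Fin m) K) (s : Set (Fin m → ℤ)) : Submodule K (QuantumTorus Q) :=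
  Submodule.span K {t | ∃ β ∈ s, ∃ u, HasDegree Q β u ∧ (u : QuantumTorus Q) = t}

theorem HasDegree.mem_homog {β : Fin m → ℤ} {u : (QuantumTorus Q)ˣ} (hu : HasDegree Q β u)
    {s : Set (Fin m → ℤ)} (hs : β ∈ s) : (u : QuantumTorus Q) ∈ homog Q s :=
  Submodule.subset_span ⟨β, hs, u, hu, rfl⟩

theorem homog_mono {s t : Set (Fin m → ℤ)} (h : s ⊆ t) : homog Q s ≤ homog Q t :=
  Submodule.span_mono fun _ ⟨β, hβ, hu⟩ => ⟨β, h hβ, hu⟩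

theorem mul_mem_homog {s s' r : Set (Fin m → ℤ)} (h : ∀ β ∈ s, ∀ γ ∈ s', β + γ ∈ r)
    {a b : QuantumTorus Q} (ha : a ∈ homog Q s) (hb : b ∈ homog Q s') : a * b ∈ homog Q r := by
  have hab := Submodule.mul_mem_mul ha hb
  rw [homog, homog, Submodule.span_mul_span] at hab
  refine Submodule.span_mono ?_ hab
  rintro _ ⟨_, ⟨β, hβ, u, hu, rfl⟩, _, ⟨γ, hγ, v, hv, rfl⟩, rfl⟩
  exact ⟨β + γ, h β hβ γ hγ, u * v, hu.mul hv, rfl⟩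

theorem one_mem_homog {s : Set (Fin m → ℤ)} (h : 0 ∈ s) : (1 : QuantumTorus Q) ∈ homog Q s :=
  HasDegree.one.mem_homog h

/-- Monomials with exponents in an additive submonoid span a subalgebra. -/
theorem adjoin_le_homog {s : AddSubmonoid (Fin m → ℤ)} {G : Set (QuantumTorus Q)}
    (hG : G ⊆ homog Q s) {t : QuantumTorus Q} (ht : t ∈ Algebra.adjoin K G) :
    t ∈ homog Q s := by
  induction ht using Algebra.adjoin_induction with
  | mem t ht => exact hG ht
  | algebraMap r =>
    rw [Algebra.algebraMap_eq_smul_one]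
    exact Submodule.smul_mem _ _ (one_mem_homog s.zero_mem)
  | add a b _ _ ha hb => exact add_mem ha hb
  | mul a b _ _ ha hb => exact mul_mem_homog (fun _ h _ h' => s.add_mem h h') ha hb

theorem homog_univ (Q : Matrix (Fin m) (Fin m) K) : homog Q Set.univ = ⊤ := by
  refine top_unique fun t _ => ?_
  have ht : t ∈ Algebra.adjoin K (Set.range (x Q) ∪ Set.range (xInv Q)) := by
    rw [adjoin_range]; trivial
  refine adjoin_le_homog (s := ⊤) ?_ ht
  rintro _ (⟨i, rfl⟩ | ⟨i, rfl⟩)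
  · exact (HasDegree.x i).mem_homog trivial
  · exact (HasDegree.x i).inv.mem_homog trivial

/-- A Laurent monomial with exponent vector `β`. -/
def mon (Q : Matrix (Fin m) (Fin m) K) (β : Fin m → ℤ) : (QuantumTorus Q)ˣ :=
  (exists_hasDegree Q β).choose

theorem hasDegree_mon (Q : Matrix (Fin m) (Fin m) K) (β : Fin m → ℤ) : HasDegree Q β (mon Q β) :=
  (exists_hasDegree Q β).choose_spec

theorem homog_eq_span_mon (hQ : IsMulAntisymm Q) (s : Set (Fin m → ℤ)) :
    homog Q s = Submodule.span K ((fun β => (mon Q β : QuantumTorus Q)) '' s) := by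
  apply le_antisymm
  · refine Submodule.span_le.2 ?_
    rintro _ ⟨β, hβ, u, hu, rfl⟩
    obtain ⟨c, rfl⟩ := (hasDegree_mon Q β).exists_scalar hQ hu
    rw [Units.val_mul, val_scalar, ← Algebra.smul_def]
    exact Submodule.smul_mem _ _ (Submodule.subset_span ⟨β, hβ, rfl⟩)
  · refine Submodule.span_le.2 ?_
    rintro _ ⟨β, hβ, rfl⟩
    exact (hasDegree_mon Q β).mem_homog hβ

/-- The basis of Laurent monomials. -/
def monBasis (hQ : IsMulAntisymm Q) : Module.Basis (Fin m → ℤ) K (QuantumTorus Q) :=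
  Module.Basis.mk (linearIndependent_of_hasDegree hQ Function.injective_id (hasDegree_mon Q)) (by
    have := (homog_univ Q).symm.trans (homog_eq_span_mon hQ _)
    rw [Set.image_univ] at this
    exact this.le)

@[simp] theorem monBasis_apply (hQ : IsMulAntisymm Q) (β : Fin m → ℤ) :
    monBasis hQ β = mon Q β := by
  simp [monBasis]

theorem mem_homog_iff (hQ : IsMulAntisymm Q) {s : Set (Fin m → ℤ)} {t : QuantumTorus Q} :
    t ∈ homog Q s ↔ ∀ β, (monBasis hQ).repr t β ≠ 0 → β ∈ s := by
  have : homog Q s = Submodule.span K (monBasis hQ '' s) := by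
    rw [homog_eq_span_mon hQ]
    simp
  rw [this, Module.Basis.mem_span_image]
  simp [Set.subset_def]

theorem eq_zero_of_mem_homog (hQ : IsMulAntisymm Q) {s s' : Set (Fin m → ℤ)} (h : Disjoint s s')
    {t : QuantumTorus Q} (ht : t ∈ homog Q s) (ht' : t ∈ homog Q s') : t = 0 := by
  rw [mem_homog_iff hQ] at ht ht'
  rw [← (monBasis hQ).repr.map_eq_zero_iff]
  ext β
  by_contra hβ
  exact Set.disjoint_left.1 h (ht β hβ) (ht' β hβ)

/-- Conjugation by a homogeneous unit preserves supports. -/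
theorem HasDegree.conj_mem_homog {β : Fin m → ℤ} {u : (QuantumTorus Q)ˣ} (hu : HasDegree Q β u)
    {s : Set (Fin m → ℤ)} {t : QuantumTorus Q} (ht : t ∈ homog Q s) :
    u * t * ↑u⁻¹ ∈ homog Q s := by
  refine mul_mem_homog (s := (β + ·) '' s) (s' := {-β}) ?_
    (mul_mem_homog (s := {β}) ?_ (hu.mem_homog rfl) ht) (hu.inv.mem_homog rfl)
  · rintro _ ⟨γ, hγ, rfl⟩ _ rfl
    simpa using hγ
  · rintro _ rfl γ hγ
    exact ⟨γ, hγ, rfl⟩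

theorem repr_toricHom (hQ : IsMulAntisymm Q) (Λ : Fin m → Kˣ) (t : QuantumTorus Q)
    (β : Fin m → ℤ) : (monBasis hQ).repr (toricHom Q Λ t) β =
      ((∏ i, Λ i ^ β i : Kˣ) : K) * (monBasis hQ).repr t β := by
  suffices h : (Finsupp.lapply β ∘ₗ (monBasis hQ).repr.toLinearMap) ∘ₗ (toricHom Q Λ).toLinearMap =
      ((∏ i, Λ i ^ β i : Kˣ) : K) • (Finsupp.lapply β ∘ₗ (monBasis hQ).repr.toLinearMap) from
    LinearMap.congr_fun h t
  refine (monBasis hQ).ext fun γ => ?_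
  have : toricHom Q Λ (monBasis hQ γ) = ((∏ i, Λ i ^ γ i : Kˣ) : K) • monBasis hQ γ := by
    rw [monBasis_apply, (hasDegree_mon Q γ).toric]
  simp only [LinearMap.comp_apply, AlgHom.toLinearMap_apply, this, map_smul, LinearMap.smul_apply,
    LinearEquiv.coe_coe, Module.Basis.repr_self, Finsupp.lapply_apply, smul_eq_mul]
  by_cases h : γ = β
  · rw [h]
  · simp [h]

end QuantumTorus

/-! ### Quantum affine space as the nonnegative part of the quantum torus. -/

namespace QuantumSpace

variable {K : Type*} [Field K] {m : ℕ} {Q : Matrix (Fin m) (Fin m) K}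

/-- The inclusion of quantum affine space into the quantum torus. -/
def toTorus (Q : Matrix (Fin m) (Fin m) K) : QuantumSpace Q →ₐ[K] QuantumTorus Q :=
  lift (QuantumTorus.x Q) (QuantumTorus.x_mul_x Q)

@[simp] theorem toTorus_x (Q : Matrix (Fin m) (Fin m) K) (i : Fin m) :
    toTorus Q (x Q i) = QuantumTorus.x Q i := by
  simp [toTorus]

theorem toTorus_toricHom (Q : Matrix (Fin m) (Fin m) K) (Λ : Fin m → Kˣ) (a : QuantumSpace Q) :
    toTorus Q (toricHom Q Λ a) = QuantumTorus.toricHom Q Λ (toTorus Q a) := by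
  have : (toTorus Q).comp (toricHom Q Λ) = (QuantumTorus.toricHom Q Λ).comp (toTorus Q) :=
    hom_ext fun i => by simp
  exact DFunLike.congr_fun this a

/-- The product of generators along a list of indices. -/
def word (Q : Matrix (Fin m) (Fin m) K) (l : List (Fin m)) : QuantumSpace Q := (l.map (x Q)).prod

theorem word_perm {l l' : List (Fin m)} (h : l.Perm l') :
    ∃ c : K, word Q l = c • word Q l' := by
  induction h with
  | nil => exact ⟨1, by simp⟩
  | cons i _ ih =>
    obtain ⟨c, hc⟩ := ih
    refine ⟨c, ?_⟩
    simp only [word, List.map_cons, List.prod_cons] at hc ⊢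
    rw [hc, mul_smul_comm]
  | swap i j l =>
    refine ⟨Q j i, ?_⟩
    simp only [word, List.map_cons, List.prod_cons]
    rw [← mul_assoc, x_mul_x Q j i, smul_mul_assoc, mul_assoc]
  | trans _ _ h₁ h₂ =>
    obtain ⟨c, hc⟩ := h₁
    obtain ⟨d, hd⟩ := h₂
    exact ⟨c * d, by rw [hc, hd, smul_smul]⟩

theorem toTorus_word (l : List (Fin m)) :
    toTorus Q (word Q l) = ((l.map (QuantumTorus.xUnit Q)).prod : (QuantumTorus Q)ˣ) := by
  induction l with
  | nil => simp [word]
  | cons i l ih =>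
    simp only [word, List.map_cons, List.prod_cons, map_mul, toTorus_x, Units.val_mul,
      QuantumTorus.val_xUnit] at ih ⊢
    rw [ih]

theorem hasDegree_word (l : List (Fin m)) :
    QuantumTorus.HasDegree Q (fun i => (l.count i : ℤ)) (l.map (QuantumTorus.xUnit Q)).prod := by
  suffices h : (fun i => (l.count i : ℤ)) = (l.map fun i => Pi.single i 1).sum by
    rw [h]
    exact QuantumTorus.HasDegree.list_prod (QuantumTorus.HasDegree.x (Q := Q)) l
  induction l with
  | nil => rfl
  | cons i l ih =>
    rw [List.map_cons, List.sum_cons, ← ih]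
    funext j
    by_cases h : i = j
    · subst h; simp [add_comm]
    · simp [h, Ne.symm h]

theorem span_word (Q : Matrix (Fin m) (Fin m) K) :
    Submodule.span K (Set.range (word Q)) = ⊤ := by
  refine top_unique fun a _ => ?_
  have ha : a ∈ Algebra.adjoin K (Set.range (x Q)) := by rw [adjoin_range_x]; trivial
  rw [← Subalgebra.mem_toSubmodule, Algebra.adjoin_eq_span] at ha
  refine Submodule.span_mono ?_ ha
  intro b hb
  induction hb using Submonoid.closure_induction with
  | mem b hb =>
    obtain ⟨i, rfl⟩ := hb
    exact ⟨[i], by simp [word]⟩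
  | one => exact ⟨[], by simp [word]⟩
  | mul b c _ _ hb hc =>
    obtain ⟨l, rfl⟩ := hb
    obtain ⟨l', rfl⟩ := hc
    exact ⟨l ++ l', by simp [word]⟩

/-- One word per exponent vector already spans, since permuting letters costs only a scalar, and the
images of these words have distinct exponents. -/
theorem toTorus_injective (hQ : IsMulAntisymm Q) : Function.Injective (toTorus Q) := by
  rw [injective_iff_map_eq_zero]
  intro a ha
  let v : (Fin m →₀ ℕ) → List (Fin m) := fun f => (Finsupp.toMultiset f).toList
  have hv : ∀ f i, (v f).count i = f i := fun f i => by
    rw [← Multiset.coe_count, Multiset.coe_toList, Finsupp.count_toMultiset]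
  have hspan : a ∈ Submodule.span K (Set.range fun f => word Q (v f)) := by
    have : a ∈ Submodule.span K (Set.range (word Q)) := by rw [span_word]; trivial
    refine Submodule.span_le.2 ?_ this
    rintro _ ⟨l, rfl⟩
    obtain ⟨c, hc⟩ := word_perm (Q := Q) (l := l) (l' := v (Multiset.toFinsupp (l : Multiset _)))
      (List.perm_iff_count.2 fun i => by simp [hv])
    rw [hc]
    exact Submodule.smul_mem _ _ (Submodule.subset_span ⟨_, rfl⟩)
  obtain ⟨c, rfl⟩ := Finsupp.mem_span_range_iff_exists_finsupp.1 hspan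
  have hli := QuantumTorus.linearIndependent_of_hasDegree hQ
    (β := fun f : Fin m →₀ ℕ => fun i => ((v f).count i : ℤ)) (fun f g h => by
      ext i
      have := congrFun h i
      simpa [hv] using this) fun f => hasDegree_word (v f)
  have : c = 0 := by
    refine linearIndependent_iff.1 hli c ?_
    rw [Finsupp.linearCombination_apply, ← ha, map_finsuppSum]
    simp [toTorus_word]
  simp [this]

theorem range_toTorus (hQ : IsMulAntisymm Q) {t : QuantumTorus Q} :
    t ∈ (toTorus Q).range ↔ t ∈ QuantumTorus.homog Q {β | ∀ i, 0 ≤ β i} := by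
  constructor
  · rintro ⟨a, rfl⟩
    have ha : a ∈ Submodule.span K (Set.range (word Q)) := by rw [span_word]; trivial
    change (toTorus Q).toLinearMap a ∈ _
    rw [← Submodule.mem_comap]
    refine Submodule.span_le.2 ?_ ha
    rintro _ ⟨l, rfl⟩
    rw [Submodule.comap_coe, Set.mem_preimage, AlgHom.toLinearMap_apply, toTorus_word]
    exact (hasDegree_word l).mem_homog fun i => by positivity
  · intro ht
    change t ∈ Subalgebra.toSubmodule (toTorus Q).range
    refine Submodule.span_le.2 ?_ ht
    rintro _ ⟨β, hβ, u, hu, rfl⟩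
    let l := (Finsupp.toMultiset (Finsupp.equivFunOnFinite.symm fun i => (β i).toNat)).toList
    have hl : (fun i => (l.count i : ℤ)) = β := by
      ext i
      rw [← Multiset.coe_count, Multiset.coe_toList, Finsupp.count_toMultiset]
      simpa using hβ i
    obtain ⟨c, rfl⟩ := (hl ▸ hasDegree_word (Q := Q) l).exists_scalar hQ hu
    rw [Units.val_mul, QuantumTorus.val_scalar, ← Algebra.smul_def, ← toTorus_word]
    exact Submodule.smul_mem _ _ ⟨_, rfl⟩

end QuantumSpace

/-! ### Skew derivations become inner on the torus. -/

section SkewDerivation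

open QuantumTorus

variable {K : Type*} [Field K] {n : ℕ} {Q : Matrix (Fin n) (Fin n) K}

theorem mul_x (hQ : IsMulAntisymm Q) (i : Fin n) (t : QuantumTorus Q) :
    t * x Q i = x Q i * toricHom Q (fun k => hQ.unit k i) t := by
  rw [x_mul hQ]
  congr 1
  have : (toricHom Q (hQ.unit i)).comp (toricHom Q fun k => hQ.unit k i) = AlgHom.id K _ :=
    QuantumTorus.hom_ext (fun k => by simp [smul_smul, ← hQ.unit_inv i])
      fun k => by simp [smul_smul, ← hQ.unit_inv i]
  exact (DFunLike.congr_fun this t).symm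

/-- Otherwise conjugation by x^α would be σ. This is the only way in which outerness enters. -/
theorem exists_mu_ne (hQ : IsMulAntisymm Q) {Λ : Fin n → Kˣ}
    (hσ : ¬ IsInnerAut (QuantumTorus.toric Q Λ)) (α : Fin n → ℤ) : ∃ i, mu hQ α i ≠ Λ i := by
  by_contra! h
  obtain rfl : mu hQ α = Λ := funext h
  refine hσ ⟨(mon Q α)⁻¹, fun t => ?_⟩
  rw [inv_inv, (hasDegree_mon Q α).mul_eq hQ, Units.mul_inv_cancel_right]
  rfl

theorem IsSkewDerivation.map_one {R : Type*} [Ring R] [Algebra K R] {σ : R ≃ₐ[K] R}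
    {δ : R →ₗ[K] R} (hδ : IsSkewDerivation σ δ) : δ 1 = 0 := by
  simpa using hδ 1 1

/-- A skew derivation of quantum affine space becomes inner on the quantum torus when the
automorphism is outer there. -/
theorem exists_inner (hQ : IsMulAntisymm Q) {Λ : Fin n → Kˣ}
    (hσ : ¬ IsInnerAut (QuantumTorus.toric Q Λ)) {δ : QuantumSpace Q →ₗ[K] QuantumSpace Q}
    (hδ : IsSkewDerivation (QuantumSpace.toric Q Λ) δ) :
    ∃ d : QuantumTorus Q, ∀ r, QuantumSpace.toTorus Q (δ r) =
      d * QuantumSpace.toTorus Q r - toricHom Q Λ (QuantumSpace.toTorus Q r) * d := by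
  have hδ' : ∀ r s, δ (r * s) = QuantumSpace.toricHom Q Λ r * δ s + δ r * s := hδ
  let inc := QuantumSpace.toTorus Q
  let conj : Fin n → QuantumTorus Q → QuantumTorus Q := fun i => toricHom Q fun k => hQ.unit k i
  have hconj : ∀ i t, t * x Q i = x Q i * conj i t := mul_x hQ
  -- Stripping x_i from δ(x_i) turns the equation for d into one that is diagonal in the monomial
  -- basis: (mu_i - λ_i) d_α = (c_i)_α.
  let c : Fin n → QuantumTorus Q := fun i => xInv Q i * inc (δ (QuantumSpace.x Q i))
  have hc : ∀ i, inc (δ (QuantumSpace.x Q i)) = x Q i * c i := fun i => by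
    rw [← mul_assoc, x_mul_xInv, one_mul]
  -- Apply δ to both sides of x_i x_j = q_ij x_j x_i and cancel the unit x_i x_j.
  have hrel : ∀ i j, conj j (c i) - (Λ j : K) • c i = conj i (c j) - (Λ i : K) • c j := by
    intro i j
    have h := congrArg (fun a => inc (δ a)) (QuantumSpace.x_mul_x Q i j)
    simp only [map_smul, hδ', map_add, map_mul, hc, QuantumSpace.toricHom_x] at h
    simp only [inc, QuantumSpace.toTorus_x] at h
    have e : ∀ i j, (Λ i : K) • x Q i * (x Q j * c j) + x Q i * c i * x Q j =
        x Q i * x Q j * ((Λ i : K) • c j + conj j (c i)) := fun i j => by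
      rw [mul_assoc (x Q i) (c i), hconj, mul_add, mul_smul_comm, smul_mul_assoc, mul_assoc,
        mul_assoc]
    rw [e, e, ← smul_mul_assoc (Q i j), ← x_mul_x] at h
    have h' := ((xUnit Q i * xUnit Q j).mul_right_inj).1 h
    rw [sub_eq_sub_iff_add_eq_add, add_comm, h', add_comm]
  have hcoef : ∀ i j α, ((mu hQ α j : K) - Λ j) * (monBasis hQ).repr (c i) α =
      ((mu hQ α i : K) - Λ i) * (monBasis hQ).repr (c j) α := by
    intro i j α
    have h := congrArg (fun t => (monBasis hQ).repr t α) (hrel i j)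
    simp only [conj, map_sub, map_smul, Finsupp.sub_apply, Finsupp.smul_apply, repr_toricHom,
      smul_eq_mul] at h
    rw [sub_mul, sub_mul]
    exact h
  choose j hj using exists_mu_ne hQ hσ
  have hj' : ∀ α, (mu hQ α (j α) : K) - Λ (j α) ≠ 0 := fun α =>
    sub_ne_zero.2 fun h => hj α (Units.ext h)
  -- Solve for d_α using one index j(α) whose factor is invertible; `hcoef` makes this solution
  -- valid for every other index too.
  let dc : (Fin n → ℤ) →₀ K := Finsupp.onFinset
    (Finset.univ.biUnion fun i => ((monBasis hQ).repr (c i)).support)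
    (fun α => (monBasis hQ).repr (c (j α)) α / ((mu hQ α (j α) : K) - Λ (j α)))
    fun α hα => by
      simp only [Finset.mem_biUnion, Finset.mem_univ, true_and, Finsupp.mem_support_iff]
      exact ⟨j α, (div_ne_zero_iff.1 hα).1⟩
  let d := (monBasis hQ).repr.symm dc
  have hd : ∀ i, conj i d - (Λ i : K) • d = c i := by
    intro i
    apply (monBasis hQ).repr.injective
    ext α
    simp only [conj, map_sub, map_smul, Finsupp.sub_apply, Finsupp.smul_apply, repr_toricHom,
      smul_eq_mul]
    have : (monBasis hQ).repr d α =
        (monBasis hQ).repr (c (j α)) α / ((mu hQ α (j α) : K) - Λ (j α)) := by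
      simp [d, dc]
    rw [this, ← sub_mul, ← mul_div_assoc, div_eq_iff (hj' α), mul_comm _ (_ - _),
      hcoef i (j α) α]
    rfl
  refine ⟨d, fun r => ?_⟩
  have hr : r ∈ Algebra.adjoin K (Set.range (QuantumSpace.x Q)) := by
    rw [QuantumSpace.adjoin_range_x]; trivial
  induction hr using Algebra.adjoin_induction with
  | mem r hr =>
    obtain ⟨i, rfl⟩ := hr
    rw [show QuantumSpace.toTorus Q (δ (QuantumSpace.x Q i)) = x Q i * c i from hc i, ← hd,
      QuantumSpace.toTorus_x, hconj, toricHom_x]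
    simp [mul_sub]
  | algebraMap r =>
    simp [Algebra.algebraMap_eq_smul_one, hδ.map_one]
  | add a b _ _ ha hb => simp only [map_add, ha, hb]; noncomm_ring
  | mul a b _ _ ha hb =>
    rw [hδ', map_add, map_mul, map_mul, ha, hb, QuantumSpace.toTorus_toricHom, map_mul, map_mul]
    simp only [mul_sub, sub_mul, mul_assoc]
    abel

/-- Reading off coefficients this way converts integrality of δ(x_i) into conditions on the
exponents of d. -/
theorem inner_generator (hQ : IsMulAntisymm Q) {Λ : Fin n → Kˣ}
    {δ : QuantumSpace Q →ₗ[K] QuantumSpace Q} {d : QuantumTorus Q}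
    (hd : ∀ r, QuantumSpace.toTorus Q (δ r) =
      d * QuantumSpace.toTorus Q r - toricHom Q Λ (QuantumSpace.toTorus Q r) * d) (i : Fin n)
    (α : Fin n → ℤ) :
    (monBasis hQ).repr (xInv Q i * QuantumSpace.toTorus Q (δ (QuantumSpace.x Q i))) α =
      ((mu hQ α i : K) - Λ i) * (monBasis hQ).repr d α := by
  rw [hd, QuantumSpace.toTorus_x, mul_x hQ, toricHom_x, smul_mul_assoc, ← mul_smul_comm, ← mul_sub,
    ← mul_assoc, xInv_mul_x, one_mul, map_sub, map_smul, Finsupp.sub_apply, repr_toricHom, sub_mul]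
  rfl

/-- The exponents of an element inducing a skew derivation of quantum affine space. -/
theorem support_inner (hQ : IsMulAntisymm Q) {Λ : Fin n → Kˣ}
    {δ : QuantumSpace Q →ₗ[K] QuantumSpace Q} {d : QuantumTorus Q}
    (hd : ∀ r, QuantumSpace.toTorus Q (δ r) =
      d * QuantumSpace.toTorus Q r - toricHom Q Λ (QuantumSpace.toTorus Q r) * d)
    {α : Fin n → ℤ} (hα : (monBasis hQ).repr d α ≠ 0) {i : Fin n} (hi : mu hQ α i ≠ Λ i)
    (j : Fin n) : 0 ≤ α j + (Pi.single i 1 : Fin n → ℤ) j := by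
  have h₁ : QuantumSpace.toTorus Q (δ (QuantumSpace.x Q i)) ∈ homog Q {β | ∀ i, 0 ≤ β i} :=
    (QuantumSpace.range_toTorus hQ).1 ⟨_, rfl⟩
  have h₂ : xInv Q i * QuantumSpace.toTorus Q (δ (QuantumSpace.x Q i)) ∈
      homog Q {β | ∀ j, 0 ≤ β j + (Pi.single i 1 : Fin n → ℤ) j} := by
    refine mul_mem_homog (s := {-Pi.single i 1}) ?_ ((HasDegree.x i).inv.mem_homog rfl) h₁
    rintro _ rfl γ hγ j
    simpa [add_comm] using hγ j
  refine (mem_homog_iff hQ).1 h₂ α ?_ j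
  rw [inner_generator hQ hd]
  exact mul_ne_zero (sub_ne_zero.2 fun h => hi (Units.ext h)) hα

end SkewDerivation

/-! ### Ore extensions: universal property, generation, normality tested on generators. -/

section OreExtension

variable {K R S B : Type*} [Field K] [Ring R] [Algebra K R] [Ring S] [Algebra K S] [Ring B]
  [Algebra K B] {σ : R ≃ₐ[K] R} {δ : R →ₗ[K] R} {f : R →ₐ[K] S} {z : S}

theorem IsOreExtension.induction (hS : IsOreExtension σ δ f z) {p : S → Prop}
    (h₀ : p 0) (hadd : ∀ s t, p s → p t → p (s + t)) (hmon : ∀ r k, p (f r * z ^ k)) (s : S) :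
    p s := by
  obtain ⟨q, rfl⟩ := hS.basis.2 s
  exact Finset.sum_induction _ p hadd h₀ fun k _ => hmon _ _

/-- The universal property of an Ore extension. -/
theorem IsOreExtension.exists_lift (hS : IsOreExtension σ δ f z) (g : R →ₐ[K] B) (y : B)
    (hy : ∀ r, y * g r = g (σ r) * y + g (δ r)) :
    ∃ φ : S →ₐ[K] B, (∀ r, φ (f r) = g r) ∧ φ z = y := by
  let F : (ℕ →₀ R) →ₗ[K] S :=
    Finsupp.lsum K fun k => (LinearMap.mulRight K (z ^ k)).comp f.toLinearMap
  let G : (ℕ →₀ R) →ₗ[K] B :=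
    Finsupp.lsum K fun k => (LinearMap.mulRight K (y ^ k)).comp g.toLinearMap
  let E := LinearEquiv.ofBijective F hS.basis
  let φ : S →ₗ[K] B := G.comp E.symm.toLinearMap
  have hφ : ∀ r k, φ (f r * z ^ k) = g r * y ^ k := by
    intro r k
    have : f r * z ^ k = E (Finsupp.single k r) := by
      change _ = F _
      simp [F]
    simp [φ, this, G]
  -- Multiplicativity is built up in the left factor: first for f r, then for z and its powers, then
  -- for sums.
  have hf : ∀ r s, φ (f r * s) = g r * φ s := by
    intro r s
    induction s using hS.induction with
    | h₀ => simp
    | hadd s t hs ht => simp [mul_add, hs, ht]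
    | hmon r' k => rw [← mul_assoc, ← map_mul, hφ, hφ, map_mul, mul_assoc]
  have hz : ∀ s, φ (z * s) = y * φ s := by
    intro s
    induction s using hS.induction with
    | h₀ => simp
    | hadd s t hs ht => simp [mul_add, hs, ht]
    | hmon r k =>
      rw [← mul_assoc, hS.comm, add_mul, mul_assoc, ← pow_succ', map_add, hφ, hφ, hφ, ← mul_assoc,
        hy, add_mul, mul_assoc, pow_succ']
  have h1 : φ 1 = 1 := by simpa using hφ 1 0
  have hpow : ∀ k s, φ (z ^ k * s) = y ^ k * φ s := by
    intro k
    induction k with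
    | zero => simp
    | succ k ih => intro s; rw [pow_succ', mul_assoc, hz, ih, pow_succ', mul_assoc]
  have hmul : ∀ s t, φ (s * t) = φ s * φ t := by
    intro s t
    induction s using hS.induction with
    | h₀ => simp
    | hadd a b ha hb => simp [add_mul, ha, hb]
    | hmon r k => rw [mul_assoc, hf, hpow, hφ, mul_assoc]
  refine ⟨AlgHom.ofLinearMap φ h1 hmul, fun r => ?_, ?_⟩
  · simpa using hφ r 0
  · simpa using hφ 1 1

theorem IsOreExtension.adjoin_eq_top (hS : IsOreExtension σ δ f z) {G : Set R}
    (hG : Algebra.adjoin K G = ⊤) : Algebra.adjoin K (f '' G ∪ {z}) = ⊤ := by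
  refine top_unique fun s _ => ?_
  have hf : ∀ r, f r ∈ Algebra.adjoin K (f '' G ∪ {z}) := fun r => by
    have : f r ∈ (Algebra.adjoin K G).map f := ⟨r, by rw [hG]; trivial, rfl⟩
    rw [AlgHom.map_adjoin] at this
    exact Algebra.adjoin_mono Set.subset_union_left this
  induction s using hS.induction with
  | h₀ => exact zero_mem _
  | hadd s t hs ht => exact add_mem (hs trivial) (ht trivial)
  | hmon r k =>
    have hz : z ∈ Algebra.adjoin K (f '' G ∪ {z}) := Algebra.subset_adjoin (Or.inr rfl)
    exact mul_mem (hf r) (pow_mem hz k)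

/-- The elements t with w t ∈ S w form a subalgebra, and likewise those with t w ∈ w S. -/
theorem isNormalElement_of_adjoin {G : Set S} (hG : Algebra.adjoin K G = ⊤) {w : S}
    (h₁ : ∀ g ∈ G, ∃ s, w * g = s * w) (h₂ : ∀ g ∈ G, ∃ s, g * w = w * s) :
    IsNormalElement w := by
  have h₁' : ∀ t, ∃ s, w * t = s * w := fun t => by
    have ht : t ∈ Algebra.adjoin K G := by rw [hG]; trivial
    induction ht using Algebra.adjoin_induction with
    | mem t ht => exact h₁ t ht
    | algebraMap r => exact ⟨_, (Algebra.commutes r w).symm⟩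
    | add a b _ _ ha hb =>
      obtain ⟨s, hs⟩ := ha
      obtain ⟨t, ht⟩ := hb
      exact ⟨s + t, by rw [mul_add, add_mul, hs, ht]⟩
    | mul a b _ _ ha hb =>
      obtain ⟨s, hs⟩ := ha
      obtain ⟨t, ht⟩ := hb
      exact ⟨s * t, by rw [← mul_assoc, hs, mul_assoc, ht, mul_assoc]⟩
  have h₂' : ∀ t, ∃ s, t * w = w * s := fun t => by
    have ht : t ∈ Algebra.adjoin K G := by rw [hG]; trivial
    induction ht using Algebra.adjoin_induction with
    | mem t ht => exact h₂ t ht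
    | algebraMap r => exact ⟨_, Algebra.commutes r w⟩
    | add a b _ _ ha hb =>
      obtain ⟨s, hs⟩ := ha
      obtain ⟨t, ht⟩ := hb
      exact ⟨s + t, by rw [mul_add, add_mul, hs, ht]⟩
    | mul a b _ _ ha hb =>
      obtain ⟨s, hs⟩ := ha
      obtain ⟨t, ht⟩ := hb
      exact ⟨s * t, by rw [mul_assoc, ht, ← mul_assoc, hs, mul_assoc]⟩
  ext t
  constructor
  · rintro ⟨s, rfl⟩
    obtain ⟨s', hs'⟩ := h₂' s
    exact ⟨s', hs'.symm⟩
  · rintro ⟨s, rfl⟩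
    obtain ⟨s', hs'⟩ := h₁' s
    exact ⟨s', hs'.symm⟩

end OreExtension

/-! ### Ore localization at the powers of one element. -/

section OreLocalization

theorem nonempty_oreSet_powers {R : Type*} [Monoid R] {x : R}
    (hx : ∀ r s, r * x = s * x → r = s) (h : ∀ r a, ∃ b r', x ^ b * r = r' * x ^ a) :
    Nonempty (OreLocalization.OreSet (Submonoid.powers x)) := by
  have hpow : ∀ (a : ℕ) r s, r * x ^ a = s * x ^ a → r = s := by
    intro a
    induction a with
    | zero => simp
    | succ a ih =>
      intro r s hrs
      rw [pow_succ, ← mul_assoc, ← mul_assoc] at hrs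
      exact ih _ _ (hx _ _ hrs)
  choose b r' hb using h
  choose a ha using fun s : Submonoid.powers x => Submonoid.mem_powers_iff _ _ |>.1 s.2
  exact ⟨{
    ore_right_cancel := fun r₁ r₂ s hs => ⟨1, by
      rw [← ha s] at hs
      rw [hpow _ _ _ hs]⟩
    oreNum := fun r s => r' r (a s)
    oreDenom := fun r s => ⟨x ^ b r (a s), _, rfl⟩
    ore_eq := fun r s => by rw [← ha s]; exact hb r (a s) }⟩

variable {K S C : Type*} [Field K] [Ring S] [Algebra K S] [Ring C] [Algebra K C]

/-- A criterion for an overring to be the localization at the powers of an element. -/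
theorem exists_oreLocalization_algEquiv {φ : S →ₐ[K] C} (hφ : Function.Injective φ) {x : S}
    (v : Cˣ) (hv : φ x = v) (hl : ∀ c : C, ∃ (b : ℕ) (s : S), φ s = v ^ b * c)
    (hr : ∀ c : C, ∃ (b : ℕ) (s : S), φ s = c * v ^ b) :
    Nonempty (OreLocalization.OreSet (Submonoid.powers (MulOpposite.op x))) ∧
      ∃ (_ : OreLocalization.OreSet (Submonoid.powers x))
        (e : OreLocalization (Submonoid.powers x) S ≃ₐ[K] C),
        ∀ s, e (OreLocalization.numeratorHom s) = φ s := by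
  constructor
  -- The right Ore condition in S is the left one in the opposite ring.
  · refine nonempty_oreSet_powers (fun r s h => ?_) fun r a => ?_
    · apply MulOpposite.unop_injective
      apply hφ
      have := congrArg (fun t => φ t.unop) h
      simpa [hv] using this
    -- The identity r x^b = x^a s comes from clearing the denominator of v⁻ᵃ φ(r) on the right.
    · obtain ⟨b, s, hs⟩ := hr (↑(v ^ a)⁻¹ * φ r.unop)
      refine ⟨b, MulOpposite.op s, MulOpposite.unop_injective (hφ ?_)⟩
      simp only [MulOpposite.unop_mul, MulOpposite.unop_pow, MulOpposite.unop_op, map_mul, map_pow,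
        hv, hs]
      rw [← mul_assoc, ← mul_assoc, ← Units.val_pow_eq_pow_val v a, Units.mul_inv, one_mul]
  · obtain ⟨hO⟩ : Nonempty (OreLocalization.OreSet (Submonoid.powers x)) := by
      refine nonempty_oreSet_powers (fun r s h => ?_) fun r a => ?_
      · apply hφ
        have := congrArg φ h
        simpa [hv] using this
      · obtain ⟨b, s, hs⟩ := hl (φ r * ↑(v ^ a)⁻¹)
        refine ⟨b, s, hφ ?_⟩
        simp only [map_mul, map_pow, hv, hs]
        rw [mul_assoc, mul_assoc, ← Units.val_pow_eq_pow_val v a, Units.inv_mul, mul_one]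
    refine ⟨hO, ?_⟩
    have hu : ∀ s : Submonoid.powers x,
        IsUnit (((φ : S →* C).comp (Submonoid.powers x).subtype) s) := by
      rintro ⟨_, a, rfl⟩
      simpa [hv] using v.isUnit.pow a
    let fS : Submonoid.powers x →* Cˣ := IsUnit.liftRight _ hu
    have hfS : ∀ s : Submonoid.powers x, (φ : S →+* C) s = fS s := fun s => rfl
    let ψ := OreLocalization.universalHom (φ : S →+* C) fS hfS
    have hψ : ∀ s, ψ (OreLocalization.numeratorHom s) = φ s := fun s =>
      OreLocalization.universalHom_commutes (φ : S →+* C) fS hfS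
    let ψ' : OreLocalization (Submonoid.powers x) S →ₐ[K] C :=
      { ψ with
        commutes' := fun r => (hψ (algebraMap K S r)).trans (φ.commutes r) }
    refine ⟨AlgEquiv.ofBijective ψ' ⟨?_, fun c => ?_⟩, hψ⟩
    · rw [injective_iff_map_eq_zero]
      intro q hq
      induction q using OreLocalization.ind with
      | _ r s =>
        have h : (↑(fS s)⁻¹ : C) * φ r = 0 :=
          (OreLocalization.universalHom_apply (φ : S →+* C) fS hfS).symm.trans hq
        rw [Units.mul_right_eq_zero] at h
        rw [hφ (h.trans (map_zero φ).symm), OreLocalization.zero_oreDiv]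
    · obtain ⟨b, s, hs⟩ := hl c
      refine ⟨OreLocalization.oreDiv s ⟨x ^ b, b, rfl⟩, ?_⟩
      refine (OreLocalization.universalHom_apply (φ : S →+* C) fS hfS).trans ?_
      change _ * φ s = c
      rw [hs, Units.inv_mul_eq_iff_eq_mul, ← hfS]
      simp [hv]

end OreLocalization

/-! ### Adjoining one generator to a quantum torus. -/

theorem QuantumTorus.toricHom_toricHom {K : Type*} [Field K] {n : ℕ} (Q : Matrix (Fin n) (Fin n) K)
    (Λ Λ' : Fin n → Kˣ) (t : QuantumTorus Q) :
    toricHom Q Λ (toricHom Q Λ' t) = toricHom Q (Λ * Λ') t := by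
  have : (toricHom Q Λ).comp (toricHom Q Λ') = toricHom Q (Λ * Λ') :=
    hom_ext (fun i => by simp [smul_smul, mul_comm]) fun i => by simp [smul_smul, mul_comm]
  exact DFunLike.congr_fun this t

/-- The matrix `Q'` obtained from `Q` by appending the row with entries `c_i`. -/
def extendMatrix {K : Type*} [Field K] {n : ℕ} (Q : Matrix (Fin n) (Fin n) K) (c : Fin n → Kˣ) :
    Matrix (Fin (n + 1)) (Fin (n + 1)) K :=
  fun i j => Fin.lastCases (motive := fun _ => K)
    (Fin.lastCases (motive := fun _ => K) 1 (fun j => (c j : K)) j)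
    (fun i => Fin.lastCases (motive := fun _ => K) ((c i)⁻¹ : Kˣ) (fun j => Q i j) j) i

section ExtendMatrix

variable {K : Type*} [Field K] {n : ℕ} (Q : Matrix (Fin n) (Fin n) K) (c : Fin n → Kˣ)

@[simp] theorem extendMatrix_castSucc_castSucc (i j : Fin n) :
    extendMatrix Q c i.castSucc j.castSucc = Q i j := by
  simp [extendMatrix]

@[simp] theorem extendMatrix_last_castSucc (i : Fin n) :
    extendMatrix Q c (Fin.last n) i.castSucc = c i := by
  simp [extendMatrix]

theorem isMulAntisymm_extendMatrix (hQ : IsMulAntisymm Q) :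
    IsMulAntisymm (extendMatrix Q c) := by
  refine ⟨fun i => ?_, fun i j => ?_⟩
  · induction i using Fin.lastCases with
    | last => simp [extendMatrix]
    | cast i => simp [hQ.1]
  · induction i using Fin.lastCases with
    | last =>
      induction j using Fin.lastCases with
      | last => simp [extendMatrix]
      | cast j => simp [extendMatrix]
    | cast i =>
      induction j using Fin.lastCases with
      | last => simp [extendMatrix]
      | cast j => simpa using hQ.2 i j

end ExtendMatrix

namespace QuantumTorus

variable {K : Type*} [Field K] {n : ℕ} {Q : Matrix (Fin n) (Fin n) K} {c : Fin n → Kˣ}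

/-- The inclusion of the quantum torus for `Q` into that for the extended matrix. -/
def extend (Q : Matrix (Fin n) (Fin n) K) (c : Fin n → Kˣ) :
    QuantumTorus Q →ₐ[K] QuantumTorus (extendMatrix Q c) :=
  lift (fun i => xUnit _ i.castSucc) fun i j => by
    simp [x_mul_x _ i.castSucc j.castSucc]

@[simp] theorem extend_x (i : Fin n) : extend Q c (x Q i) = x _ i.castSucc :=
  lift_x _ _ i

/-- Extension of exponent vectors by zero. -/
def extendExp (β : Fin n → ℤ) : Fin (n + 1) → ℤ :=
  fun i => Fin.lastCases (motive := fun _ => ℤ) 0 β i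

@[simp] theorem extendExp_castSucc (β : Fin n → ℤ) (i : Fin n) : extendExp β i.castSucc = β i := by
  simp [extendExp]

@[simp] theorem extendExp_last (β : Fin n → ℤ) : extendExp β (Fin.last n) = 0 := by
  simp [extendExp]

theorem HasDegree.extend {β : Fin n → ℤ} {u : (QuantumTorus Q)ˣ} (hu : HasDegree Q β u) :
    HasDegree (extendMatrix Q c) (extendExp β)
      (Units.map (extend Q c : QuantumTorus Q →* QuantumTorus (extendMatrix Q c)) u) := by
  induction hu with
  | x i =>
    convert HasDegree.x (Q := extendMatrix Q c) i.castSucc using 1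
    · ext j
      induction j using Fin.lastCases with
      | last => simp [(Fin.castSucc_ne_last i).symm]
      | cast j => simp [Pi.single_apply]
    · ext
      simp
  | scalar a =>
    convert HasDegree.scalar (Q := extendMatrix Q c) a using 1
    · ext j
      induction j using Fin.lastCases <;> simp
    · ext
      simp [val_scalar]
  | @mul β γ u v _ _ h₁ h₂ =>
    rw [map_mul]
    convert h₁.mul h₂ using 1
    ext j
    induction j using Fin.lastCases <;> simp
  | @inv β u _ h =>
    rw [map_inv]
    convert h.inv using 1
    ext j
    induction j using Fin.lastCases <;> simp

theorem extend_injective (hQ : IsMulAntisymm Q) (c : Fin n → Kˣ) :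
    Function.Injective (extend Q c) := by
  rw [injective_iff_map_eq_zero]
  intro t ht
  have hli := linearIndependent_of_hasDegree (isMulAntisymm_extendMatrix Q c hQ)
    (β := fun β : Fin n → ℤ => extendExp β)
    (fun β γ h => funext fun i => by simpa using congrFun h i.castSucc)
    fun β => (hasDegree_mon Q β).extend
  rw [← (monBasis hQ).repr.map_eq_zero_iff]
  refine linearIndependent_iff.1 hli _ ?_
  rw [← (monBasis hQ).linearCombination_repr t, Finsupp.linearCombination_apply,
    map_finsuppSum] at ht
  rw [Finsupp.linearCombination_apply, ← ht]
  simp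

theorem extend_mem_homog {s : Set (Fin n → ℤ)} {s' : Set (Fin (n + 1) → ℤ)}
    (h : ∀ β ∈ s, extendExp β ∈ s') {t : QuantumTorus Q} (ht : t ∈ homog Q s) :
    extend Q c t ∈ homog (extendMatrix Q c) s' := by
  induction ht using Submodule.span_induction with
  | mem t ht =>
    obtain ⟨β, hβ, u, hu, rfl⟩ := ht
    exact (hu.extend (c := c)).mem_homog (h β hβ)
  | zero => simp
  | add a b _ _ ha hb => rw [map_add]; exact add_mem ha hb
  | smul r a _ ha => rw [map_smul]; exact Submodule.smul_mem _ _ ha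

/-- Conjugation by the new generator acts on the smaller quantum torus as a toric automorphism. -/
theorem last_mul_extend (t : QuantumTorus Q) :
    x (extendMatrix Q c) (Fin.last n) * extend Q c t =
      extend Q c (toricHom Q c t) * x (extendMatrix Q c) (Fin.last n) :=
  intertwine (h := (extend Q c).comp (toricHom Q c)) (fun i => by
    simp [x_mul_x _ (Fin.last n) i.castSucc]) t

/-- The product `x_J` as a unit of the quantum torus. -/
def xProdUnit (Q : Matrix (Fin n) (Fin n) K) (J : Finset (Fin n)) : (QuantumTorus Q)ˣ :=
  ((J.sort (· ≤ ·)).map (xUnit Q)).prod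

theorem toTorus_xProd (J : Finset (Fin n)) :
    QuantumSpace.toTorus Q (QuantumSpace.xProd Q J) = xProdUnit Q J :=
  QuantumSpace.toTorus_word _

/-- The indicator vector of `J`. -/
def indicatorExp (J : Finset (Fin n)) (i : Fin n) : ℤ := if i ∈ J then 1 else 0

theorem hasDegree_xProdUnit (J : Finset (Fin n)) :
    HasDegree Q (indicatorExp J) (xProdUnit Q J) := by
  have h : indicatorExp J = fun i => ((J.sort (· ≤ ·)).count i : ℤ) := by
    ext i
    rw [indicatorExp, (Finset.sort_nodup J _).count]
    simp
  rw [h]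
  exact QuantumSpace.hasDegree_word _

theorem prod_zpow_indicatorExp (J : Finset (Fin n)) (a : Fin n → Kˣ) :
    ∏ i, a i ^ indicatorExp J i = ∏ i ∈ J, a i := by
  simp [indicatorExp, Finset.prod_ite_mem]

theorem mu_indicatorExp (hQ : IsMulAntisymm Q) (J : Finset (Fin n)) (i : Fin n) :
    mu hQ (indicatorExp J) i = ∏ j ∈ J, hQ.unit j i :=
  prod_zpow_indicatorExp J _

end QuantumTorus

/-! ### Exponents and weights of the element d. -/

namespace QuantumTorus

variable {K : Type*} [Field K] {n : ℕ} {Q : Matrix (Fin n) (Fin n) K}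

/-- The indices at which some exponent of `d` is negative. -/
def negIndices (hQ : IsMulAntisymm Q) (d : QuantumTorus Q) : Finset (Fin n) :=
  open Classical in Finset.univ.filter fun i => ∃ α, (monBasis hQ).repr d α ≠ 0 ∧ α i < 0

theorem mem_negIndices (hQ : IsMulAntisymm Q) {d : QuantumTorus Q} {i : Fin n} :
    i ∈ negIndices hQ d ↔ ∃ α, (monBasis hQ).repr d α ≠ 0 ∧ α i < 0 := by
  simp [negIndices]

/-- The condition on `d` that the inner skew derivation it defines has, on each generator `x_i`,
value in quantum affine space. -/
def IsAdmissible (hQ : IsMulAntisymm Q) (Λ : Fin n → Kˣ) (d : QuantumTorus Q) : Prop :=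
  ∀ α, (monBasis hQ).repr d α ≠ 0 → ∀ i, mu hQ α i ≠ Λ i →
    ∀ j, 0 ≤ α j + (Pi.single i 1 : Fin n → ℤ) j

variable {hQ : IsMulAntisymm Q} {Λ : Fin n → Kˣ} {d : QuantumTorus Q}

theorem IsAdmissible.mu_eq (hd : IsAdmissible hQ Λ d) {α : Fin n → ℤ}
    (hα : (monBasis hQ).repr d α ≠ 0) {i : Fin n} (hi : α i < 0) {j : Fin n} (hj : j ≠ i) :
    mu hQ α j = Λ j := by
  by_contra h
  have := hd α hα j h i
  rw [Pi.single_eq_of_ne hj.symm] at this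
  lia

/-- Some index k has mu_k ≠ λ_k, and by `IsAdmissible.mu_eq` it can only be the position of the
negative entry; admissibility at k then bounds all entries. -/
theorem IsAdmissible.eq_neg_one (hd : IsAdmissible hQ Λ d)
    (hσ : ¬ IsInnerAut (QuantumTorus.toric Q Λ)) {α : Fin n → ℤ}
    (hα : (monBasis hQ).repr d α ≠ 0) {i : Fin n} (hi : α i < 0) :
    α i = -1 ∧ ∀ j ≠ i, 0 ≤ α j := by
  obtain ⟨k, hk⟩ := exists_mu_ne hQ hσ α
  obtain rfl : k = i := by
    by_contra h
    exact hk (hd.mu_eq hα hi h)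
  refine ⟨?_, fun j hj => ?_⟩
  · have := hd α hα k hk k
    rw [Pi.single_eq_same] at this
    lia
  · have := hd α hα k hk j
    rwa [Pi.single_eq_of_ne hj, add_zero] at this

theorem IsAdmissible.add_indicatorExp_nonneg (hd : IsAdmissible hQ Λ d)
    (hσ : ¬ IsInnerAut (QuantumTorus.toric Q Λ)) {α : Fin n → ℤ}
    (hα : (monBasis hQ).repr d α ≠ 0) (i : Fin n) :
    0 ≤ indicatorExp (negIndices hQ d) i + α i := by
  rcases lt_or_ge (α i) 0 with hi | hi
  · rw [indicatorExp, if_pos ((mem_negIndices hQ).2 ⟨α, hα, hi⟩), (hd.eq_neg_one hσ hα hi).1]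
    simp
  · exact add_nonneg (by rw [indicatorExp]; split_ifs <;> simp) hi

/-- The weight of a monomial with a negative exponent under conjugation by `x_{n+1}`. -/
theorem IsAdmissible.weight_eq (hd : IsAdmissible hQ Λ d)
    (hσ : ¬ IsInnerAut (QuantumTorus.toric Q Λ)) {α : Fin n → ℤ}
    (hα : (monBasis hQ).repr d α ≠ 0) {i : Fin n} (hi : α i < 0) :
    (∏ j ∈ negIndices hQ d, Λ j) *
      ∏ k, (Λ * mu hQ (indicatorExp (negIndices hQ d))) k ^ α k = 1 := by
  have := nontrivial hQ
  set J := negIndices hQ d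
  have hiJ : i ∈ J := (mem_negIndices hQ).2 ⟨α, hα, hi⟩
  -- Moving x_J past x^α is inverse to moving x^α past x_J.
  have h₁ : ∏ k, mu hQ (indicatorExp J) k ^ α k = (∏ j ∈ J, mu hQ α j)⁻¹ := by
    simp_rw [mu_indicatorExp, ← Finset.prod_zpow]
    rw [Finset.prod_comm, ← Finset.prod_inv_distrib]
    refine Finset.prod_congr rfl fun j _ => ?_
    rw [mu, ← Finset.prod_inv_distrib]
    refine Finset.prod_congr rfl fun k _ => ?_
    rw [← hQ.unit_inv, inv_zpow]
  -- λ_k and mu_k differ only at k = i, where the exponent is -1, and ∏ mu_k^{α_k} = 1.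
  have h₂ : ∏ k, Λ k ^ α k = (Λ i * (mu hQ α i)⁻¹)⁻¹ := by
    have : ∏ k, (Λ k * (mu hQ α k)⁻¹) ^ α k = (Λ i * (mu hQ α i)⁻¹)⁻¹ := by
      rw [Finset.prod_eq_single i]
      · rw [(hd.eq_neg_one hσ hα hi).1, zpow_neg_one]
      · intro j _ hj
        rw [hd.mu_eq hα hi hj, mul_inv_cancel, one_zpow]
      · simp
    rw [← this]
    simp_rw [mul_zpow, inv_zpow]
    rw [Finset.prod_mul_distrib, Finset.prod_inv_distrib, prod_mu_zpow, inv_one, mul_one]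
  -- Only the factor at i ∈ J survives, and it cancels against `h₂`.
  have h₃ : (∏ j ∈ J, Λ j) * (∏ j ∈ J, mu hQ α j)⁻¹ = Λ i * (mu hQ α i)⁻¹ := by
    rw [← Finset.prod_inv_distrib, ← Finset.prod_mul_distrib]
    refine Finset.prod_eq_single_of_mem i hiJ fun j _ hj => ?_
    rw [hd.mu_eq hα hi hj, mul_inv_cancel]
  simp_rw [Pi.mul_apply, mul_zpow]
  rw [Finset.prod_mul_distrib, h₁, h₂, mul_left_comm, h₃, inv_mul_cancel]

theorem IsAdmissible.xProdUnit_mul_mem (hd : IsAdmissible hQ Λ d)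
    (hσ : ¬ IsInnerAut (QuantumTorus.toric Q Λ)) :
    (xProdUnit Q (negIndices hQ d) : QuantumTorus Q) * d ∈ (QuantumSpace.toTorus Q).range := by
  rw [QuantumSpace.range_toTorus hQ]
  refine mul_mem_homog (s := {indicatorExp (negIndices hQ d)})
    (s' := {α | (monBasis hQ).repr d α ≠ 0}) ?_ ((hasDegree_xProdUnit _).mem_homog rfl)
    ((mem_homog_iff hQ).2 fun _ h => h)
  rintro _ rfl α hα i
  exact hd.add_indicatorExp_nonneg hσ hα i

/-- This element b is the correction in w z = (P⁻¹ z + b) w; by `IsAdmissible.weight_eq` its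
coefficient vanishes wherever an exponent is negative. -/
theorem IsAdmissible.sub_mem (hd : IsAdmissible hQ Λ d)
    (hσ : ¬ IsInnerAut (QuantumTorus.toric Q Λ)) :
    toricHom Q (Λ * mu hQ (indicatorExp (negIndices hQ d))) d -
      ((∏ j ∈ negIndices hQ d, Λ j)⁻¹ : Kˣ) • d ∈ (QuantumSpace.toTorus Q).range := by
  rw [QuantumSpace.range_toTorus hQ, mem_homog_iff hQ]
  intro α hα i
  rw [Units.smul_def, map_sub, map_smul, Finsupp.sub_apply, Finsupp.smul_apply, repr_toricHom,
    smul_eq_mul, ← sub_mul] at hα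
  by_contra! hi
  refine left_ne_zero_of_mul hα (sub_eq_zero.2 (congrArg _ ?_))
  rw [eq_inv_iff_mul_eq_one, mul_comm]
  exact hd.weight_eq hσ (right_ne_zero_of_mul hα) hi

theorem isAdmissible_of_inner {δ : QuantumSpace Q →ₗ[K] QuantumSpace Q}
    (hd : ∀ r, QuantumSpace.toTorus Q (δ r) =
      d * QuantumSpace.toTorus Q r - toricHom Q Λ (QuantumSpace.toTorus Q r) * d) :
    IsAdmissible hQ Λ d :=
  fun _ hα _ hi => support_inner hQ hd hα hi

/-- Off the negative indices, `δ(x_i)` is a multiple of `x_i`. -/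
theorem IsAdmissible.apply_x_mem (h : IsAdmissible hQ Λ d)
    {δ : QuantumSpace Q →ₗ[K] QuantumSpace Q}
    (hd : ∀ r, QuantumSpace.toTorus Q (δ r) =
      d * QuantumSpace.toTorus Q r - toricHom Q Λ (QuantumSpace.toTorus Q r) * d)
    {i : Fin n} (hi : i ∉ negIndices hQ d) :
    ∃ a b, δ (QuantumSpace.x Q i) = QuantumSpace.x Q i * a ∧
      δ (QuantumSpace.x Q i) = b * QuantumSpace.x Q i := by
  set t := xInv Q i * QuantumSpace.toTorus Q (δ (QuantumSpace.x Q i)) with ht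
  have h₀ : QuantumSpace.toTorus Q (δ (QuantumSpace.x Q i)) = x Q i * t := by
    rw [ht, ← mul_assoc, x_mul_xInv, one_mul]
  have h₁ : t ∈ homog Q {β | ∀ i, 0 ≤ β i} := by
    rw [mem_homog_iff hQ]
    intro α hα j
    rw [inner_generator hQ hd] at hα
    by_contra! hj
    have hαd := right_ne_zero_of_mul hα
    -- A negative entry sits at some j ∈ J, hence j ≠ i, so the factor mu_i - λ_i is zero.
    refine left_ne_zero_of_mul hα (sub_eq_zero.2 (congrArg _ (h.mu_eq hαd hj ?_)))
    rintro rfl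
    exact hi ((mem_negIndices hQ).2 ⟨α, hαd, hj⟩)
  obtain ⟨a, ha⟩ := (QuantumSpace.range_toTorus hQ).2 h₁
  -- Conjugation by x_i keeps the exponents, which turns the right cofactor into a left one.
  obtain ⟨b, hb⟩ := (QuantumSpace.range_toTorus hQ).2 ((HasDegree.x i).conj_mem_homog h₁)
  change QuantumSpace.toTorus Q a = _ at ha
  change QuantumSpace.toTorus Q b = _ at hb
  refine ⟨a, b, QuantumSpace.toTorus_injective hQ ?_, QuantumSpace.toTorus_injective hQ ?_⟩
  · rw [map_mul, ha, h₀, QuantumSpace.toTorus_x]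
  · rw [map_mul, hb, h₀, QuantumSpace.toTorus_x, mul_assoc, val_inv_xUnit, xInv_mul_x, mul_one,
      val_xUnit]

end QuantumTorus

/-! ### The element θ and the degree in the last variable. -/

namespace QuantumTorus

variable {K : Type*} [Field K] {n : ℕ} {Q : Matrix (Fin n) (Fin n) K}

/-- The matrix with last row `λ_i ∏_{j ∈ J} q_{ji}`. -/
abbrev locMatrix (hQ : IsMulAntisymm Q) (Λ : Fin n → Kˣ) (J : Finset (Fin n)) :
    Matrix (Fin (n + 1)) (Fin (n + 1)) K :=
  extendMatrix Q (Λ * mu hQ (indicatorExp J))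

variable (hQ : IsMulAntisymm Q) (Λ : Fin n → Kˣ) (J : Finset (Fin n))

theorem isMulAntisymm_locMatrix : IsMulAntisymm (locMatrix hQ Λ J) :=
  isMulAntisymm_extendMatrix _ _ hQ

/-- The inclusion of the quantum torus into the one for `locMatrix`. -/
abbrev locExtend : QuantumTorus Q →ₐ[K] QuantumTorus (locMatrix hQ Λ J) :=
  extend Q (Λ * mu hQ (indicatorExp J))

/-- The image of `x_J` in the larger quantum torus. -/
def locProd : (QuantumTorus (locMatrix hQ Λ J))ˣ :=
  Units.map (locExtend hQ Λ J : QuantumTorus Q →* QuantumTorus (locMatrix hQ Λ J)) (xProdUnit Q J)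

theorem val_locProd : (locProd hQ Λ J : QuantumTorus (locMatrix hQ Λ J)) =
    locExtend hQ Λ J (xProdUnit Q J) := rfl

theorem hasDegree_locProd :
    HasDegree (locMatrix hQ Λ J) (extendExp (indicatorExp J)) (locProd hQ Λ J) :=
  (hasDegree_xProdUnit J).extend

/-- The element `x_J⁻¹ x_{n+1}`. -/
def theta : (QuantumTorus (locMatrix hQ Λ J))ˣ :=
  (locProd hQ Λ J)⁻¹ * xUnit _ (Fin.last n)

theorem locProd_mul_theta : (locProd hQ Λ J * theta hQ Λ J : QuantumTorus (locMatrix hQ Λ J)) =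
    x _ (Fin.last n) := by
  simp [theta]

theorem hasDegree_theta :
    HasDegree (locMatrix hQ Λ J) (-extendExp (indicatorExp J) + Pi.single (Fin.last n) 1)
      (theta hQ Λ J) :=
  (hasDegree_locProd hQ Λ J).inv.mul (HasDegree.x _)

/-- x_{n+1} = x_J θ conjugates by `Λ * mu hQ (indicatorExp J)` and x_J by the second factor, leaving
σ for θ. The last row of Q' is chosen for this. -/
theorem theta_mul_extend (t : QuantumTorus Q) :
    theta hQ Λ J * locExtend hQ Λ J t = locExtend hQ Λ J (toricHom Q Λ t) * theta hQ Λ J := by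
  rw [← Units.mul_right_inj (locProd hQ Λ J), ← mul_assoc, locProd_mul_theta, last_mul_extend,
    ← mul_assoc, val_locProd, ← map_mul, (hasDegree_xProdUnit J).mul_eq hQ, toricHom_toricHom,
    map_mul, mul_assoc, ← val_locProd, locProd_mul_theta,
    mul_comm (mu hQ (indicatorExp J)) Λ]

theorem theta_mul_last : theta hQ Λ J * x (locMatrix hQ Λ J) (Fin.last n) =
    ((∏ j ∈ J, Λ j : Kˣ) : K) • (x (locMatrix hQ Λ J) (Fin.last n) * theta hQ Λ J) := by
  rw [← locProd_mul_theta, ← mul_assoc, val_locProd, theta_mul_extend,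
    (hasDegree_xProdUnit J).toric, prod_zpow_indicatorExp, map_smul, smul_mul_assoc,
    smul_mul_assoc]

/-- The elements of degree at most `a` in the last variable. -/
def lastLE (Q : Matrix (Fin (n + 1)) (Fin (n + 1)) K) (a : ℤ) : Submodule K (QuantumTorus Q) :=
  homog Q {β | β (Fin.last n) ≤ a}

theorem mul_mem_lastLE {Q : Matrix (Fin (n + 1)) (Fin (n + 1)) K} {a b e : ℤ} (h : a + b ≤ e)
    {s t : QuantumTorus Q} (hs : s ∈ lastLE Q a) (ht : t ∈ lastLE Q b) : s * t ∈ lastLE Q e :=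
  mul_mem_homog (fun _ h₁ _ h₂ => (add_le_add h₁ h₂).trans h) hs ht

theorem extend_mem_lastLE {c : Fin n → Kˣ} (t : QuantumTorus Q) :
    extend Q c t ∈ lastLE (extendMatrix Q c) 0 :=
  extend_mem_homog (s := Set.univ) (fun β _ => by simp) (by rw [homog_univ]; trivial)

theorem HasDegree.mem_lastLE {Q : Matrix (Fin (n + 1)) (Fin (n + 1)) K} {β : Fin (n + 1) → ℤ}
    {u : (QuantumTorus Q)ˣ} (hu : HasDegree Q β u) {a : ℤ} (h : β (Fin.last n) ≤ a) :
    (u : QuantumTorus Q) ∈ lastLE Q a :=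
  hu.mem_homog h

theorem lastLE_mono {Q : Matrix (Fin (n + 1)) (Fin (n + 1)) K} {a b : ℤ} (h : a ≤ b) :
    lastLE Q a ≤ lastLE Q b :=
  homog_mono fun _ h' => le_trans h' h

theorem theta_pow_mem (k : ℕ) :
    (theta hQ Λ J : QuantumTorus (locMatrix hQ Λ J)) ^ k ∈ lastLE (locMatrix hQ Λ J) k := by
  rw [← Units.val_pow_eq_pow_val]
  exact ((hasDegree_theta hQ Λ J).pow k).mem_lastLE (by simp)

/-- θ has degree 1 and d degree 0 in x_{n+1}, so θ^k is the leading term of (θ + d)^k. -/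
theorem add_pow_sub_mem (d : QuantumTorus Q) (k : ℕ) :
    ((theta hQ Λ J : QuantumTorus (locMatrix hQ Λ J)) + locExtend hQ Λ J d) ^ k -
      (theta hQ Λ J : QuantumTorus (locMatrix hQ Λ J)) ^ k ∈ lastLE (locMatrix hQ Λ J) (k - 1) := by
  induction k with
  | zero => simp
  | succ k ih =>
    set θ := (theta hQ Λ J).val
    set e := locExtend hQ Λ J d
    have : (θ + e) ^ (k + 1) - θ ^ (k + 1) = (θ + e) * ((θ + e) ^ k - θ ^ k) + e * θ ^ k := by
      rw [pow_succ', pow_succ', mul_sub, add_mul θ e (θ ^ k)]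
      abel
    rw [this]
    refine add_mem (mul_mem_lastLE (a := 1) ?_ (add_mem ?_ ?_) ih) (mul_mem_lastLE ?_
      (extend_mem_lastLE d) (theta_pow_mem hQ Λ J k))
    · push_cast; linarith
    · simpa using theta_pow_mem hQ Λ J 1
    · exact lastLE_mono (by norm_num) (extend_mem_lastLE d)
    · push_cast; linarith

/-- If the sum vanished, the top term e(p_N) θ^N would have degree at most N - 1; dividing by θ^N
leaves e(p_N), of degree 0, with degree at most -1. -/
theorem sum_extend_ne_zero (d : QuantumTorus Q) {p : ℕ →₀ QuantumTorus Q} (hp : p ≠ 0) :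
    (p.sum fun k t => locExtend hQ Λ J t *
      ((theta hQ Λ J : QuantumTorus (locMatrix hQ Λ J)) + locExtend hQ Λ J d) ^ k) ≠ 0 := by
  intro h0
  set θ := (theta hQ Λ J).val with hθ
  set e := locExtend hQ Λ J
  have hne : p.support.Nonempty := Finsupp.support_nonempty_iff.2 hp
  set N := p.support.max' hne
  have hN : N ∈ p.support := p.support.max'_mem hne
  have hsum : e (p N) * θ ^ N ∈ lastLE (locMatrix hQ Λ J) (N - 1) := by
    rw [Finsupp.sum, ← Finset.add_sum_erase _ _ hN] at h0
    have : e (p N) * θ ^ N = -(e (p N) * ((θ + e d) ^ N - θ ^ N) +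
        ∑ k ∈ p.support.erase N, e (p k) * (θ + e d) ^ k) := by
      rw [mul_sub, ← sub_eq_zero, ← h0]
      abel
    rw [this]
    refine neg_mem (add_mem (mul_mem_lastLE (by simp) (extend_mem_lastLE _)
      (add_pow_sub_mem hQ Λ J d N)) (sum_mem fun k hk => ?_))
    have hk' : k < N := lt_of_le_of_ne (Finset.le_max' _ _ (Finset.mem_of_mem_erase hk))
      (Finset.ne_of_mem_erase hk)
    refine mul_mem_lastLE (b := k) (by lia) (extend_mem_lastLE _) ?_
    rw [← sub_add_cancel ((θ + e d) ^ k) (θ ^ k)]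
    exact add_mem (lastLE_mono (by simp) (add_pow_sub_mem hQ Λ J d k)) (theta_pow_mem hQ Λ J k)
  have h₁ : e (p N) ∈ lastLE (locMatrix hQ Λ J) (-1) := by
    have h₂ := mul_mem_lastLE (e := -1) (b := -N) (by lia) hsum
      (((hasDegree_theta hQ Λ J).pow N).inv.mem_lastLE (by simp))
    rwa [hθ, ← Units.val_pow_eq_pow_val, Units.mul_inv_cancel_right] at h₂
  have h₂ : e (p N) ∈ homog (locMatrix hQ Λ J) {β | β (Fin.last n) = 0} :=
    extend_mem_homog (s := Set.univ) (fun β _ => by simp) (by rw [homog_univ]; trivial)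
  suffices h₃ : e (p N) = 0 from
    Finsupp.mem_support_iff.1 hN (extend_injective hQ _ (h₃.trans (map_zero _).symm))
  refine eq_zero_of_mem_homog (isMulAntisymm_locMatrix hQ Λ J) ?_ h₁ h₂
  rw [Set.disjoint_left]
  intro β hβ hβ'
  simp only [Set.mem_ofPred_eq] at hβ hβ'
  lia

end QuantumTorus

section Embedding

open QuantumTorus

variable {K : Type*} [Field K] {n : ℕ} {Q : Matrix (Fin n) (Fin n) K} (hQ : IsMulAntisymm Q)
  {Λ : Fin n → Kˣ} {δ : QuantumSpace Q →ₗ[K] QuantumSpace Q} {S : Type*} [Ring S] [Algebra K S]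
  {f : QuantumSpace Q →ₐ[K] S} {z : S} {d : QuantumTorus Q}

/-- The embedding of an Ore extension into a quantum torus. -/
theorem IsOreExtension.exists_embedding (hS : IsOreExtension (QuantumSpace.toric Q Λ) δ f z)
    (hd : ∀ r, QuantumSpace.toTorus Q (δ r) =
      d * QuantumSpace.toTorus Q r - toricHom Q Λ (QuantumSpace.toTorus Q r) * d)
    (J : Finset (Fin n)) :
    ∃ φ : S →ₐ[K] QuantumTorus (locMatrix hQ Λ J), Function.Injective φ ∧
      (∀ r, φ (f r) = locExtend hQ Λ J (QuantumSpace.toTorus Q r)) ∧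
      φ z = theta hQ Λ J + locExtend hQ Λ J d := by
  -- θ + d satisfies the Ore relation, since θ r = σ(r) θ and d r = σ(r) d + δ(r).
  obtain ⟨φ, hf, hz⟩ := hS.exists_lift ((locExtend hQ Λ J).comp (QuantumSpace.toTorus Q))
    (theta hQ Λ J + locExtend hQ Λ J d) fun r => by
      have : QuantumSpace.toTorus Q (QuantumSpace.toric Q Λ r) =
        toricHom Q Λ (QuantumSpace.toTorus Q r) := QuantumSpace.toTorus_toricHom Q Λ r
      simp only [AlgHom.comp_apply, add_mul, mul_add, hd, map_sub, map_mul, theta_mul_extend, this]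
      abel
  refine ⟨φ, ?_, hf, hz⟩
  rw [injective_iff_map_eq_zero]
  intro s hs
  obtain ⟨p, rfl⟩ := hS.basis.2 s
  by_contra hp
  refine sum_extend_ne_zero hQ Λ J d (p := p.mapRange (QuantumSpace.toTorus Q) (map_zero _)) ?_ ?_
  · intro h
    have : p = 0 := Finsupp.mapRange_injective _ (map_zero _) (QuantumSpace.toTorus_injective hQ)
      (h.trans Finsupp.mapRange_zero.symm)
    exact hp (by simp [this])
  · rw [Finsupp.sum_mapRange_index (by simp), ← hs]
    simp [map_finsuppSum, hf, hz]

end Embedding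

/-! ### Clearing denominators in the selectively localized space. -/

namespace QuantumTorus

variable {K : Type*} [Field K] {n : ℕ} {Q : Matrix (Fin n) (Fin n) K}

/-- Exponent vectors that are nonnegative off `I`. -/
def nonnegOff (I : Finset (Fin n)) : AddSubmonoid (Fin n → ℤ) where
  carrier := {β | ∀ i, i ∉ I → 0 ≤ β i}
  zero_mem' := fun _ _ => le_rfl
  add_mem' := fun ha hb i hi => add_nonneg (ha i hi) (hb i hi)

theorem selectivelyLocalized_le_homog {I : Finset (Fin n)} {t : QuantumTorus Q}
    (ht : t ∈ selectivelyLocalizedQuantumSpace Q I) : t ∈ homog Q (nonnegOff I) := by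
  refine adjoin_le_homog ?_ ht
  rintro _ (⟨i, rfl⟩ | ⟨i, hi, rfl⟩)
  · refine (HasDegree.x i).mem_homog fun j _ => ?_
    rw [Pi.single_apply]
    split_ifs <;> simp
  · refine (HasDegree.x i).inv.mem_homog fun j hj => ?_
    rw [Pi.neg_apply, Pi.single_eq_of_ne (by rintro rfl; exact hj hi), neg_zero]

/-- Multiplication by a high power of a monomial involving every `x_i` with `i ∈ I` clears
denominators. -/
theorem exists_pow_mul_mem {I : Finset (Fin n)} {α : Fin n → ℤ} {v : (QuantumTorus Q)ˣ}
    (hv : HasDegree Q α v) (hα : ∀ i, 0 ≤ α i) (hI : ∀ i ∈ I, 1 ≤ α i) {t : QuantumTorus Q}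
    (ht : t ∈ homog Q (nonnegOff I)) :
    ∃ b : ℕ, ∀ k ≥ b, (v : QuantumTorus Q) ^ k * t ∈ homog Q {β | ∀ i, 0 ≤ β i} ∧
      t * (v : QuantumTorus Q) ^ k ∈ homog Q {β | ∀ i, 0 ≤ β i} := by
  induction ht using Submodule.span_induction with
  | mem t ht =>
    obtain ⟨β, hβ, u, hu, rfl⟩ := ht
    -- A single bound that dominates every |β_i|.
    refine ⟨∑ i, (β i).natAbs, fun k hk => ?_⟩
    have h : ∀ i, 0 ≤ k * α i + β i := by
      intro i
      by_cases hi : i ∈ I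
      · have h₁ : (β i).natAbs ≤ k :=
          (Finset.single_le_sum (f := fun i => (β i).natAbs) (fun _ _ => Nat.zero_le _)
            (Finset.mem_univ i)).trans hk
        have h₂ : (k : ℤ) * 1 ≤ k * α i := mul_le_mul_of_nonneg_left (hI i hi) (by positivity)
        lia
      · exact add_nonneg (mul_nonneg (by positivity) (hα i)) (hβ i hi)
    constructor
    · exact ((hv.pow k).mul hu).mem_homog fun i => by simpa using h i
    · exact (hu.mul (hv.pow k)).mem_homog fun i => by simpa [add_comm] using h i
  | zero => exact ⟨0, by simp⟩
  | add s t _ _ hs ht =>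
    obtain ⟨a, ha⟩ := hs
    obtain ⟨b, hb⟩ := ht
    -- Working with all k ≥ b lets the bounds of two summands be combined.
    refine ⟨max a b, fun k hk => ?_⟩
    rw [mul_add, add_mul]
    have h₁ := ha k (le_of_max_le_left hk)
    have h₂ := hb k (le_of_max_le_right hk)
    exact ⟨add_mem h₁.1 h₂.1, add_mem h₁.2 h₂.2⟩
  | smul c t _ ht =>
    obtain ⟨b, hb⟩ := ht
    refine ⟨b, fun k hk => ?_⟩
    rw [mul_smul_comm, smul_mul_assoc]
    exact ⟨Submodule.smul_mem _ _ (hb k hk).1, Submodule.smul_mem _ _ (hb k hk).2⟩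

theorem x_mem_selectivelyLocalized (I : Finset (Fin n)) (i : Fin n) :
    x Q i ∈ selectivelyLocalizedQuantumSpace Q I :=
  Algebra.subset_adjoin (Or.inl ⟨i, rfl⟩)

theorem range_toTorus_le_of_x_mem {B : Subalgebra K (QuantumTorus Q)} (h : ∀ i, x Q i ∈ B) :
    (QuantumSpace.toTorus Q).range ≤ B := by
  rw [← Algebra.map_top, ← QuantumSpace.adjoin_range_x, AlgHom.map_adjoin, Algebra.adjoin_le_iff]
  rintro _ ⟨_, ⟨i, rfl⟩, rfl⟩
  rw [QuantumSpace.toTorus_x]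
  exact h i

variable (hQ : IsMulAntisymm Q) (Λ : Fin n → Kˣ) (J : Finset (Fin n))

/-- The selectively localized quantum space for `locMatrix`. -/
abbrev locSpace : Subalgebra K (QuantumTorus (locMatrix hQ Λ J)) :=
  selectivelyLocalizedQuantumSpace (locMatrix hQ Λ J) (J.map Fin.castSuccEmb)

theorem locExtend_toTorus_mem {B : Subalgebra K (QuantumTorus (locMatrix hQ Λ J))}
    (h : ∀ i : Fin n, x (locMatrix hQ Λ J) i.castSucc ∈ B) {t : QuantumTorus Q}
    (ht : t ∈ (QuantumSpace.toTorus Q).range) : locExtend hQ Λ J t ∈ B := by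
  have : (QuantumSpace.toTorus Q).range ≤ B.comap (locExtend hQ Λ J) :=
    range_toTorus_le_of_x_mem fun i => by
      rw [Subalgebra.mem_comap, extend_x]
      exact h i
  exact this ht

theorem inv_locProd_mem : (↑(locProd hQ Λ J)⁻¹ : QuantumTorus (locMatrix hQ Λ J)) ∈
    locSpace hQ Λ J := by
  have key : ∀ l : List (Fin n), (∀ i ∈ l, i ∈ J) →
      locExtend hQ Λ J ↑((l.map (xUnit Q)).prod)⁻¹ ∈ locSpace hQ Λ J := by
    intro l
    induction l with
    | nil => simp
    | cons i l ih =>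
      intro h
      rw [List.map_cons, List.prod_cons, mul_inv_rev, Units.val_mul, map_mul]
      refine mul_mem (ih fun j hj => h j (List.mem_cons_of_mem _ hj)) ?_
      have : locExtend hQ Λ J ↑(xUnit Q i)⁻¹ = xInv _ i.castSucc := by
        rw [← Units.mul_right_inj (xUnit _ i.castSucc), val_xUnit, x_mul_xInv, ← extend_x,
          ← map_mul, val_inv_xUnit, x_mul_xInv, map_one]
      rw [this]
      refine Algebra.subset_adjoin (Or.inr ⟨i.castSucc, ?_, rfl⟩)
      simpa using h i List.mem_cons_self
  exact key _ fun i hi => (Finset.mem_sort _).1 hi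

theorem locProd_mem : (locProd hQ Λ J : QuantumTorus (locMatrix hQ Λ J)) ∈ locSpace hQ Λ J :=
  locExtend_toTorus_mem hQ Λ J (fun _ => x_mem_selectivelyLocalized _ _)
    ⟨_, toTorus_xProd J⟩

/-- `x_J` as a unit of the selectively localized quantum space. -/
def locProdUnit : (locSpace hQ Λ J)ˣ :=
  ⟨⟨_, locProd_mem hQ Λ J⟩, ⟨_, inv_locProd_mem hQ Λ J⟩, Subtype.ext (Units.mul_inv _),
    Subtype.ext (Units.inv_mul _)⟩

end QuantumTorus

end

/-! ### Assembly of the theorem. -/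

open QuantumTorus

theorem mainTheorem7 {K : Type*} [Field K] {n : ℕ} (Q : Matrix (Fin n) (Fin n) K)
    (hQ : IsMulAntisymm Q) (Λ : Fin n → Kˣ)
    (hσ : ¬ IsInnerAut (QuantumTorus.toric Q Λ))
    (δ : QuantumSpace Q →ₗ[K] QuantumSpace Q)
    (hδ : IsSkewDerivation (QuantumSpace.toric Q Λ) δ)
    {S : Type*} [Ring S] [Algebra K S] (f : QuantumSpace Q →ₐ[K] S) (z : S)
    (hS : IsOreExtension (QuantumSpace.toric Q Λ) δ f z) :
    ∃ (w : S) (J : Finset (Fin n)) (Q' : Matrix (Fin (n + 1)) (Fin (n + 1)) K),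
      IsNormalElement w ∧
      IsMulAntisymm Q' ∧
      (∀ i j : Fin n, Q' i.castSucc j.castSucc = Q i j) ∧
      (∀ i : Fin n, Q' (Fin.last n) i.castSucc = (Λ i : K) * ∏ j ∈ J, Q j i) ∧
      -- the powers of `x` form a right and left Ore set, and the localization `S_x` is
      -- `O_{Q'}(K^{n+1})_{⟨J⟩}` with canonical generators `x_1, …, x_n` and `x_{n+1} = w`
      Nonempty (OreLocalization.OreSet
        (Submonoid.powers (MulOpposite.op (f (QuantumSpace.xProd Q J))))) ∧
      (∃ (_ : OreLocalization.OreSet (Submonoid.powers (f (QuantumSpace.xProd Q J))))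
        (e : OreLocalization (Submonoid.powers (f (QuantumSpace.xProd Q J))) S ≃ₐ[K]
          selectivelyLocalizedQuantumSpace Q' (J.map Fin.castSuccEmb)),
        (∀ i : Fin n, (e (OreLocalization.numeratorHom (f (QuantumSpace.x Q i))) :
          QuantumTorus Q') = QuantumTorus.x Q' i.castSucc) ∧
        (e (OreLocalization.numeratorHom w) : QuantumTorus Q') =
          QuantumTorus.x Q' (Fin.last n)) ∧
      (∀ i : Fin n, i ∉ J → IsNormalElement (f (QuantumSpace.x Q i))) := by
  obtain ⟨d, hd⟩ := exists_inner hQ hσ hδ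
  have had : IsAdmissible hQ Λ d := isAdmissible_of_inner hd
  set J := negIndices hQ d
  obtain ⟨φ, hφ, hφf, hφz⟩ := hS.exists_embedding hQ hd J
  have hφx : ∀ i, φ (f (QuantumSpace.x Q i)) = x _ i.castSucc := fun i => by simp [hφf]
  obtain ⟨a, ha⟩ := had.xProdUnit_mul_mem hσ
  change QuantumSpace.toTorus Q a = _ at ha
  have hgen := hS.adjoin_eq_top (QuantumSpace.adjoin_range_x Q)
  obtain ⟨w, hw⟩ : ∃ w, φ w = x _ (Fin.last n) := by
    -- This is x_J (z - d), as a represents x_J d.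
    refine ⟨f (QuantumSpace.xProd Q J) * z - f a, ?_⟩
    rw [map_sub, map_mul, hφf, hφf, hφz, ha, toTorus_xProd, mul_add, map_mul, add_sub_cancel_right,
      ← val_locProd, locProd_mul_theta]
  -- the selectively localized quantum space contains the Ore extension
  have hrange : ∀ s, φ s ∈ locSpace hQ Λ J := by
    have hle : φ.range ≤ locSpace hQ Λ J := by
      rw [← Algebra.map_top, ← hgen, AlgHom.map_adjoin, Algebra.adjoin_le_iff]
      rintro _ ⟨_, ⟨_, ⟨i, rfl⟩, rfl⟩ | hg, rfl⟩
      · rw [hφx]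
        exact x_mem_selectivelyLocalized _ _
      -- Only x_J has to be inverted: z = x_J⁻¹ (x_{n+1} + x_J d), and x_J d is polynomial.
      · have : φ z = (locProd hQ Λ J)⁻¹.val *
            (x _ (Fin.last n) + locExtend hQ Λ J (xProdUnit Q J * d)) := by
          rw [hφz, mul_add, map_mul, ← val_locProd, ← mul_assoc, Units.inv_mul, one_mul,
            ← locProd_mul_theta, ← mul_assoc, Units.inv_mul, one_mul]
        rw [Set.mem_singleton_iff.1 hg, this]
        exact mul_mem (inv_locProd_mem hQ Λ J) (add_mem (x_mem_selectivelyLocalized _ _)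
          (locExtend_toTorus_mem hQ Λ J (fun _ => x_mem_selectivelyLocalized _ _) ⟨a, ha⟩))
    exact fun s => hle ⟨s, rfl⟩
  have hmem : ∀ t, t ∈ homog (locMatrix hQ Λ J) {β | ∀ i, 0 ≤ β i} → ∃ s, φ s = t := by
    intro t ht
    refine range_toTorus_le_of_x_mem (B := φ.range) (fun i => ?_)
      ((QuantumSpace.range_toTorus (isMulAntisymm_locMatrix hQ Λ J)).2 ht)
    induction i using Fin.lastCases with
    | last => exact ⟨w, hw⟩
    | cast i => exact ⟨_, hφx i⟩
  let φ' : S →ₐ[K] locSpace hQ Λ J := φ.codRestrict _ hrange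
  have hclear : ∀ c : locSpace hQ Λ J, ∃ b : ℕ, ∀ k ≥ b,
      (locProd hQ Λ J : QuantumTorus (locMatrix hQ Λ J)) ^ k * c ∈
        homog (locMatrix hQ Λ J) {β | ∀ i, 0 ≤ β i} ∧
      c * (locProd hQ Λ J : QuantumTorus (locMatrix hQ Λ J)) ^ k ∈
        homog (locMatrix hQ Λ J) {β | ∀ i, 0 ≤ β i} := by
    intro c
    refine exists_pow_mul_mem (hasDegree_locProd hQ Λ J) (fun i => ?_) (fun i hi => ?_)
      (selectivelyLocalized_le_homog c.2)
    · induction i using Fin.lastCases with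
      | last => simp
      | cast i =>
        rw [extendExp_castSucc, indicatorExp]
        split_ifs <;> simp
    · obtain ⟨i, hiJ, rfl⟩ := Finset.mem_map.1 hi
      rw [Fin.coe_castSuccEmb, extendExp_castSucc, indicatorExp, if_pos hiJ]
  have hφ' : Function.Injective φ' := fun s t h => hφ (congrArg Subtype.val h)
  have hφ'x : φ' (f (QuantumSpace.xProd Q J)) = locProdUnit hQ Λ J := Subtype.ext (by
    change φ _ = locProd hQ Λ J
    rw [hφf, toTorus_xProd, val_locProd])
  have hl : ∀ c, ∃ (b : ℕ) (s : S), φ' s = (locProdUnit hQ Λ J).val ^ b * c := fun c => by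
    obtain ⟨b, hb⟩ := hclear c
    obtain ⟨s, hs⟩ := hmem _ (hb b le_rfl).1
    exact ⟨b, s, Subtype.ext hs⟩
  have hr : ∀ c, ∃ (b : ℕ) (s : S), φ' s = c * (locProdUnit hQ Λ J).val ^ b := fun c => by
    obtain ⟨b, hb⟩ := hclear c
    obtain ⟨s, hs⟩ := hmem _ (hb b le_rfl).2
    exact ⟨b, s, Subtype.ext hs⟩
  obtain ⟨hop, hO, e, he⟩ := exists_oreLocalization_algEquiv (C := locSpace hQ Λ J)
    (φ := φ') hφ' (locProdUnit hQ Λ J) hφ'x hl hr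
  refine ⟨w, J, locMatrix hQ Λ J, ?_, isMulAntisymm_locMatrix hQ Λ J,
    extendMatrix_castSucc_castSucc _ _, fun i => ?_, hop, ⟨hO, e, fun i => ?_, ?_⟩, fun i hi => ?_⟩
  · obtain ⟨b, hb⟩ := had.sub_mem hσ
    change QuantumSpace.toTorus Q b = _ at hb
    set P : Kˣ := ∏ j ∈ J, Λ j
    set c := Λ * mu hQ (indicatorExp J)
    have hθ : theta hQ Λ J * x (locMatrix hQ Λ J) (Fin.last n) =
      (P : K) • (x (locMatrix hQ Λ J) (Fin.last n) * theta hQ Λ J) := theta_mul_last hQ Λ J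
    have hcb : locExtend hQ Λ J (QuantumSpace.toTorus Q b) =
        locExtend hQ Λ J (toricHom Q c d) - (P⁻¹ : Kˣ) • locExtend hQ Λ J d := by
      rw [hb, map_sub, Units.smul_def, map_smul, ← Units.smul_def]
    have hwθ : x (locMatrix hQ Λ J) (Fin.last n) * theta hQ Λ J =
        ((P⁻¹ : Kˣ) : K) • (theta hQ Λ J * x (locMatrix hQ Λ J) (Fin.last n)) := by
      rw [hθ, smul_smul, Units.inv_mul, one_smul]
    -- Moving w past θ gives P⁻¹ and past d gives τ(d); rewriting θ as z - d leaves b = τ(d) - P⁻¹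
    -- d.
    have hwz : w * z = ((P⁻¹ : Kˣ) • z + f b) * w := by
      apply hφ
      rw [map_mul, map_mul, map_add, Units.smul_def, map_smul, hφf, hw, hφz, hcb, mul_add,
        last_mul_extend, hwθ, Units.smul_def, smul_add, add_add_sub_cancel, add_mul,
        smul_mul_assoc]
    have hwf : ∀ r, w * f r = f (QuantumSpace.toricHom Q c r) * w := fun r => by
      apply hφ
      rw [map_mul, map_mul, hφf, hφf, hw, last_mul_extend, QuantumSpace.toTorus_toricHom]
    have hfw : ∀ r, f r * w = w * f ((QuantumSpace.toric Q c).symm r) := fun r => by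
      rw [hwf]
      congr 2
      exact ((QuantumSpace.toric Q c).apply_symm_apply r).symm
    refine isNormalElement_of_adjoin hgen ?_ ?_
    · rintro _ (⟨r, -, rfl⟩ | hg)
      · exact ⟨_, hwf r⟩
      · rw [Set.mem_singleton_iff.1 hg]
        exact ⟨_, hwz⟩
    · rintro _ (⟨r, -, rfl⟩ | hg)
      · exact ⟨_, hfw r⟩
      · rw [Set.mem_singleton_iff.1 hg]
        -- Obtained by solving `hwz` for z w, with b carried to the right of w through τ⁻¹.
        refine ⟨P • (z - f ((QuantumSpace.toric Q c).symm b)), ?_⟩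
        rw [mul_smul_comm, mul_sub, ← hfw, hwz, add_mul, add_sub_cancel_right, smul_mul_assoc,
          smul_inv_smul]
  · refine (extendMatrix_last_castSucc _ _ i).trans ?_
    rw [Pi.mul_apply, mu_indicatorExp, Units.val_mul, Units.coe_prod]
    rfl
  · rw [he]
    exact hφx i
  · rw [he]
    exact hw
  · obtain ⟨a, b, ha, hb⟩ := had.apply_x_mem hd hi
    have hz : z * f (QuantumSpace.x Q i) =
        (Λ i : K) • (f (QuantumSpace.x Q i) * z) + f (δ (QuantumSpace.x Q i)) := by
      rw [hS.comm, ← smul_mul_assoc, ← map_smul, ← QuantumSpace.toricHom_x]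
      rfl
    refine isNormalElement_of_adjoin hgen ?_ ?_
    · rintro _ (⟨_, ⟨j, rfl⟩, rfl⟩ | hg)
      · refine ⟨Q i j • f (QuantumSpace.x Q j), ?_⟩
        rw [← map_mul, QuantumSpace.x_mul_x, map_smul, map_mul, smul_mul_assoc]
      · rw [Set.mem_singleton_iff.1 hg]
        -- Solve z x_i = λ_i x_i z + b x_i for x_i z.
        refine ⟨((Λ i : K))⁻¹ • (z - f b), ?_⟩
        rw [smul_mul_assoc, sub_mul, hz, hb, ← map_mul, add_sub_cancel_right,
          inv_smul_smul₀ (Λ i).ne_zero]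
    · rintro _ (⟨_, ⟨j, rfl⟩, rfl⟩ | hg)
      · refine ⟨Q j i • f (QuantumSpace.x Q j), ?_⟩
        rw [← map_mul, QuantumSpace.x_mul_x, map_smul, map_mul, mul_smul_comm]
      · rw [Set.mem_singleton_iff.1 hg]
        refine ⟨(Λ i : K) • z + f a, ?_⟩
        rw [hz, ha, map_mul, mul_add, mul_smul_comm]
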